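/- **Setting.** For a continuous $f:\mathbb T\to\mathbb C$ (or a bounded measurable one) let $f_j$, $j\in\mathbb Z$, be its Fourier coefficients, and let $T_n(f)=(f_{i-j})_{i,j=0}^{n-1}$ be its $n\times n$ Toeplitz matrix, identified with the operator $h\mapsto P_n(fh)$ on the polynomials of degree at most $n-1$ (with the norm of $L_2(\mathbb T)$). For $\alpha\ge 2$ let $\mathsf{CSL}^\alpha$ be the set of all continuous $a:\mathbb T\to\mathbb C$ with $\sum_{j\in\mathbb Z}|a_j|(|j|+1)^\alpha<\infty$ such that $g(\varphi)=a(e^{i\varphi})$ satisfies $g(\varphi)=g(2\pi-\varphi)$ on $[0,2\pi]$, $g$ is injective on $[0,\pi]$ (so its image is a simple arc with distinct end points $g(0)\neq g(\pi)$), $g'(\varphi)\ne0$ for $\varphi\in(0,\pi)$, $g''(0)\neq0$ and $g''(\pi)\ne0$. Put $a_n(t)=\sum_{|j|\le n-1}a_jt^j$ and $g_n(\psi)=a_n(e^{i\psi})$ for $\psi\in\mathbb C$. For fixed $c,C>0$ put $$\Pi_n(a)=\{\varphi+i\delta:\ \varphi\in[c/n,\pi-c/n],\ \delta\in[-C/n,C/n]\},\qquad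 \mathcal R_n(a)=g_n(\Pi_n(a)).$$ For $s\in\Pi_n(a)$ and $\lambda=g_n(s)$ put $$\hat b_n(t,\lambda)=\frac{(a_n(t)-\lambda)e^{is}}{(t-e^{is})(t^{-1}-e^{is})},\qquad \tilde b_n(t,\lambda)=\hat b_n(1/t,\lambda)\qquad(t\in\mathbb T)$$ (removable singularities being removed), and, with $\chi_0=1$, $$\Theta_{n+2}(t,\lambda)=\big[T_{n+2}(\hat b_n(\cdot,\lambda))^{-1}\chi_0\big](t),\qquad \hat\Theta_{n+2}(t,\lambda)=\big[T_{n+2}(\tilde b_n(\cdot,\lambda))^{-1}\chi_0\big](t^{-1})\qquad(t\in\mathbb C\setminus\{0\}).$$ **Theorem.** Let $\alpha\ge2$, $a\in\mathsf{CSL}^\alpha$, and $c,C>0$. There are $N_0\in\mathbb N$ and $M$, depending only on $a$, $c$, $C$, such that for all $n>N_0$: 1. $g_n$ is injective on $\Pi_n(a)$; so each $\lambda\in\mathcal R_n(a)$ is $g_n(s)$ for exactly one $s\in\Pi_n(a)$, and $\hat b_n(\cdot,\lambda)$, $\tilde b_n(\cdot,\lambda)$ depend on $\lambda$ only. 2.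 For every $\lambda\in\mathcal R_n(a)$ the operators $T_{n+2}(\hat b_n(\cdot,\lambda))$ and $T_{n+2}(\tilde b_n(\cdot,\lambda))$ are invertible, and the $L_2$ operator norms of their inverses are at most $M$. 3. For every $\lambda=g_n(s)\in\mathcal R_n(a)$, $s\in\Pi_n(a)$: $\lambda$ is an eigenvalue of $T_n(a)$ if and only if $$e^{-i(n+1)s}\,\Theta_{n+2}(e^{is},\lambda)\,\hat\Theta_{n+2}(e^{-is},\lambda)-e^{i(n+1)s}\,\Theta_{n+2}(e^{-is},\lambda)\,\hat\Theta_{n+2}(e^{is},\lambda)=0.$$ -/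

import Mathlib

/-!
Put `τ = t + t⁻¹`. Since `a` is even, `b̂_n(·, λ)` is minus the divided difference of `a_n` with
respect to `τ`, an even function, so `b̃_n = b̂_n`. As `n → ∞` these symbols approach, uniformly in
`s`, the divided differences of `a` itself, which have no zeros because `g` is injective on `[0, π]`
with `g' ≠ 0` inside and `g'' ≠ 0` at the end points.

An even symbol is a uniform limit of polynomials in `τ`, whose linear factors
`τ - (w + w⁻¹)` have explicit Wiener–Hopf factorizations. Hence the Toeplitz operator of an even
symbol without zeros has a left inverse that is a norm limit of operators lowering frequencies by a
bounded amount. It controls all but the last few coordinates of a vector by its image under the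
finite section; evenness makes the reversal of coordinates commute with the finite sections and so
gives control of the last coordinates too. The set of limit symbols is compact, and thus the finite
sections are uniformly stable near it.

Multiplying a polynomial `h` of degree less than `n` by `(X - e^{is}) (X - e^{-is})` turns
`(λ - T_n(a)) h` into the interior rows of `T_{n+2}(b̂_n)`. The vectors on which these rows vanish
are spanned by `u = T_{n+2}(b̂_n)⁻¹ χ_0` and its reversal, and the requirement that a combination
of these two vanish at `e^{is}` and `e^{-is}` is the `2 × 2` determinant of the theorem.
-/

noncomputable section

namespace ToeplitzCSL

/-- The Fourier coefficient `f_j` of a function `f` on the unit circle, i.e.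
`(2π)⁻¹ ∫ φ in 0..2π, f (exp (i φ)) * exp (-i j φ)`. -/
def coeff (f : Circle → ℂ) (j : ℤ) : ℂ :=
  haveI : Fact (0 < 2 * Real.pi) := ⟨Real.two_pi_pos⟩
  fourierCoeff (T := 2 * Real.pi) (fun x : AddCircle (2 * Real.pi) => f (AddCircle.toCircle x)) j

/-- The weighted Wiener algebra `W^α`: the (continuous) functions on the unit circle with
`∑ |a_j| (|j| + 1)^α < ∞`. -/
def MemWiener (α : ℝ) (a : Circle → ℂ) : Prop :=
  Continuous a ∧ Summable fun j : ℤ => ‖coeff a j‖ * (|(j : ℝ)| + 1) ^ α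

/-- `g(φ) = a(exp(i φ))`, for real `φ`. -/
def g (a : Circle → ℂ) (φ : ℝ) : ℂ := a (Circle.exp φ)

/-- The class `CSL^α` of complex-valued symmetric simple-loop functions. -/
structure MemCSL (α : ℝ) (a : Circle → ℂ) : Prop where
  memWiener : MemWiener α a
  symm : ∀ φ ∈ Set.Icc (0 : ℝ) (2 * Real.pi), g a φ = g a (2 * Real.pi - φ)
  simple_arc : Set.InjOn (g a) (Set.Icc 0 Real.pi)
  endpoints_ne : g a 0 ≠ g a Real.pi
  deriv_ne : ∀ φ ∈ Set.Ioo (0 : ℝ) Real.pi, deriv (g a) φ ≠ 0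
  deriv2_zero_ne : iteratedDeriv 2 (g a) 0 ≠ 0
  deriv2_pi_ne : iteratedDeriv 2 (g a) Real.pi ≠ 0

/-- The `n × n` Toeplitz matrix `T_n(f) = (f_{i-j})`, the matrix of `h ↦ P_n (f h)` in the basis
`1, t, …, t^(n-1)`. -/
def toeplitz (n : ℕ) (f : Circle → ℂ) : Matrix (Fin n) (Fin n) ℂ :=
  Matrix.of fun i j => coeff f ((i : ℤ) - (j : ℤ))

/-- The Laurent polynomial `a_n(z) = ∑_{|j| ≤ n-1} a_j z^j`, for complex `z ≠ 0`. -/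
def aN (a : Circle → ℂ) (n : ℕ) (z : ℂ) : ℂ :=
  ∑ j ∈ Finset.Icc (-((n : ℤ) - 1)) ((n : ℤ) - 1), coeff a j * z ^ j

/-- `g_n(ψ) = a_n(exp(i ψ))`, for complex `ψ`. -/
def gN (a : Circle → ℂ) (n : ℕ) (ψ : ℂ) : ℂ := aN a n (Complex.exp (Complex.I * ψ))

/-- The rectangle `Π_n = {φ + i δ : φ ∈ [c/n, π - c/n], δ ∈ [-C/n, C/n]}`. -/
def PiN (c C : ℝ) (n : ℕ) : Set ℂ :=
  {ψ | ψ.re ∈ Set.Icc (c / n) (Real.pi - c / n) ∧ ψ.im ∈ Set.Icc (-(C / n)) (C / n)}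

/-- The function `b̂_n(t, λ)` on the unit circle, for `λ = g_n(s)`:
`(a_n(t) - λ) e^{is} / ((t - e^{is}) (t⁻¹ - e^{is}))`.
For real `s` the quotient is `0 / 0` at the two points `t = e^{is}, e^{-is}` (removable
singularities of a Laurent polynomial); the value there does not matter, as only the Fourier
coefficients of this function are used. -/
def hatB (a : Circle → ℂ) (n : ℕ) (s : ℂ) (t : Circle) : ℂ :=
  (aN a n (t : ℂ) - gN a n s) * Complex.exp (Complex.I * s) /
    (((t : ℂ) - Complex.exp (Complex.I * s)) * ((t : ℂ)⁻¹ - Complex.exp (Complex.I * s)))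

/-- `b̃_n(t, λ) = b̂_n(1/t, λ)`, for `λ = g_n(s)`. -/
def tildeB (a : Circle → ℂ) (n : ℕ) (s : ℂ) (t : Circle) : ℂ := hatB a n s t⁻¹

/-- The value at `z` of the polynomial `T_{m+1}(f)⁻¹ χ_0`, where `χ_0 = 1`. -/
def invChiZero (m : ℕ) (f : Circle → ℂ) (z : ℂ) : ℂ :=
  ∑ k : Fin (m + 1), ((toeplitz (m + 1) f)⁻¹.mulVec (Pi.single 0 1)) k * z ^ (k : ℕ)

/-- `Θ_{n+2}(z, λ) = [T_{n+2}(b̂_n(·, λ))⁻¹ χ_0](z)`, for `λ = g_n(s)`. -/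
def Theta (a : Circle → ℂ) (n : ℕ) (s z : ℂ) : ℂ := invChiZero (n + 1) (hatB a n s) z

/-- `Θ̂_{n+2}(z, λ) = [T_{n+2}(b̃_n(·, λ))⁻¹ χ_0](z⁻¹)`, for `λ = g_n(s)`. -/
def hatTheta (a : Circle → ℂ) (n : ℕ) (s z : ℂ) : ℂ := invChiZero (n + 1) (tildeB a n s) z⁻¹

end ToeplitzCSL

end

noncomputable section

namespace ToeplitzCSL

open MeasureTheory AddCircle Filter Topology
open scoped ENNReal NNReal

section Multiplication

variable {X 𝕜 : Type*} [TopologicalSpace X] [CompactSpace X] [MeasurableSpace X] [BorelSpace X]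
  [RCLike 𝕜] (μ : Measure X) [IsFiniteMeasure μ] (p : ℝ≥0∞) [Fact (1 ≤ p)]

/-- Multiplication by a continuous function on `L^p`, as a bounded bilinear map. -/
def mulLp : C(X, 𝕜) →L[𝕜] Lp 𝕜 p μ →L[𝕜] Lp 𝕜 p μ :=
  ((ContinuousLinearMap.mul 𝕜 𝕜).holderL μ ∞ p p).comp (ContinuousMap.toLp (E := 𝕜) ∞ μ 𝕜)

variable {μ p}

theorem coeFn_mulLp (b : C(X, 𝕜)) (x : Lp 𝕜 p μ) : mulLp μ p b x =ᵐ[μ] fun t => b t * x t := by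
  refine ((ContinuousLinearMap.mul 𝕜 𝕜).coeFn_holder (r := p)
    (ContinuousMap.toLp (E := 𝕜) ∞ μ 𝕜 b) x).trans ?_
  filter_upwards [ContinuousMap.coeFn_toLp (p := ∞) (𝕜 := 𝕜) μ b] with t ht
  rw [ContinuousLinearMap.mul_apply', ht]

variable (μ p) in
/-- Multiplication by a continuous function on `L^p`, as a representation of the algebra of
continuous functions. -/
def mulOp : C(X, 𝕜) →ₐ[𝕜] (Lp 𝕜 p μ →L[𝕜] Lp 𝕜 p μ) :=
  AlgHom.ofLinearMap (mulLp μ p).toLinearMap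
    (by
      ext1 x
      refine Lp.ext ?_
      filter_upwards [coeFn_mulLp 1 x] with t ht
      simpa using ht)
    (fun b c => by
      ext1 x
      refine Lp.ext ?_
      filter_upwards [coeFn_mulLp (b * c) x, coeFn_mulLp b (mulLp μ p c x), coeFn_mulLp c x]
        with t hbc hb hc
      simp [hbc, hb, hc, mul_assoc])

theorem coeFn_mulOp (b : C(X, 𝕜)) (x : Lp 𝕜 p μ) : mulOp μ p b x =ᵐ[μ] fun t => b t * x t :=
  coeFn_mulLp b x

theorem continuous_mulOp : Continuous (mulOp (𝕜 := 𝕜) μ p) :=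
  (mulLp μ p).continuous

theorem norm_mulOp_le (b : C(X, 𝕜)) : ‖mulOp μ p b‖ ≤ ‖b‖ := by
  refine ContinuousLinearMap.opNorm_le_bound _ (norm_nonneg _) fun x =>
    Lp.norm_le_mul_norm_of_ae_le_mul ?_
  filter_upwards [coeFn_mulOp b x] with t ht
  rw [ht, norm_mul]
  exact mul_le_mul_of_nonneg_right (b.norm_coe_le_norm t) (norm_nonneg _)

theorem mulOp_mulOp_apply (b c : C(X, 𝕜)) (x : Lp 𝕜 p μ) :
    mulOp μ p b (mulOp μ p c x) = mulOp μ p (b * c) x := by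
  rw [map_mul, mul_apply_eq_comp]

theorem inner_star_mulOp (b : C(X, 𝕜)) (x y : Lp 𝕜 2 μ) :
    inner 𝕜 (mulOp μ 2 (star b) x) y = inner 𝕜 x (mulOp μ 2 b y) := by
  rw [L2.inner_def, L2.inner_def]
  refine integral_congr_ae ?_
  filter_upwards [coeFn_mulOp (star b) x, coeFn_mulOp b y] with t hx hy
  rw [hx, hy]
  simp only [RCLike.inner_apply, map_mul, ContinuousMap.star_apply, RCLike.star_def,
    RCLike.conj_conj]
  ring

end Multiplication

section ClosedSubalgebra

theorem tsum_pow_mem_of_isClosed {R 𝓐 : Type*} [CommSemiring R] [NormedRing 𝓐]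
    [HasSummableGeomSeries 𝓐] [Algebra R 𝓐] {S : Subalgebra R 𝓐} (hS : IsClosed (S : Set 𝓐))
    {x : 𝓐} (hx : x ∈ S) (h : ‖x‖ < 1) : ∑' n : ℕ, x ^ n ∈ S :=
  hS.mem_of_tendsto (summable_geometric_of_norm_lt_one h).hasSum
    (.of_forall fun _ => S.sum_mem fun i _ => S.pow_mem hx i)

variable {𝕜 E : Type*} [NontriviallyNormedField 𝕜] [NormedAddCommGroup E] [NormedSpace 𝕜 E]

/-- The bounded operators that map the subspace `V` to itself. -/
def invariantSubalgebra (V : Submodule 𝕜 E) : Subalgebra 𝕜 (E →L[𝕜] E) where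
  carrier := {A | ∀ x ∈ V, A x ∈ V}
  mul_mem' hA hB x hx := hA _ (hB x hx)
  add_mem' hA hB x hx := V.add_mem (hA x hx) (hB x hx)
  algebraMap_mem' c x hx := by
    simpa [Algebra.algebraMap_eq_smul_one] using V.smul_mem c hx

theorem isClosed_invariantSubalgebra {V : Submodule 𝕜 E} (hV : IsClosed (V : Set E)) :
    IsClosed (invariantSubalgebra V : Set (E →L[𝕜] E)) := by
  have hinter : (invariantSubalgebra V : Set (E →L[𝕜] E)) =
      ⋂ x ∈ V, (fun A => A x) ⁻¹' (V : Set E) := by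
    ext A
    simp only [Set.mem_iInter]
    rfl
  rw [hinter]
  exact isClosed_biInter fun x _ => hV.preimage (ContinuousLinearMap.apply 𝕜 E x).continuous

end ClosedSubalgebra

section Tail

variable (𝕜 : Type*) {E : Type*} [RCLike 𝕜] [NormedAddCommGroup E] [InnerProductSpace 𝕜 E]
  (e : ℤ → E)

/-- The vectors whose coordinates with index less than `m` vanish. -/
abbrev tail (m : ℤ) : Submodule 𝕜 E := (Submodule.span 𝕜 (e '' Set.Iio m))ᗮ

variable {𝕜 e}

theorem mem_tail {m : ℤ} {x : E} : x ∈ tail 𝕜 e m ↔ ∀ j < m, inner 𝕜 (e j) x = 0 := by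
  rw [← Submodule.span_singleton_le_iff_mem, ← Submodule.isOrtho_iff_le, Submodule.isOrtho_comm,
    Submodule.isOrtho_span]
  simp

theorem tail_anti : Antitone (tail 𝕜 e) := fun _ _ h =>
  Submodule.orthogonal_le (Submodule.span_mono (Set.image_mono (Set.Iio_subset_Iio h)))

theorem mem_tail_of_orthonormal (he : Orthonormal 𝕜 e) {m j : ℤ} (h : m ≤ j) :
    e j ∈ tail 𝕜 e m :=
  mem_tail.2 fun _ hi => he.inner_eq_zero (hi.trans_le h).ne

variable [CompleteSpace E]

variable (𝕜 e) in
/-- The orthogonal projection onto `tail 𝕜 e m`. -/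
abbrev tailProj (m : ℤ) : E →L[𝕜] E := (tail 𝕜 e m).starProjection

theorem inner_tailProj (he : Orthonormal 𝕜 e) {m j : ℤ} (h : m ≤ j) (x : E) :
    inner 𝕜 (e j) (tailProj 𝕜 e m x) = inner 𝕜 (e j) x := by
  rw [← Submodule.inner_starProjection_left_eq_right,
    Submodule.starProjection_eq_self_iff.2 (mem_tail_of_orthonormal he h)]

variable (𝕜 e) in
/-- The algebra of the operators `A` whose matrix is lower triangular up to finitely many
diagonals: `⟪e i, A (e j)⟫ = 0` for `i < j - d`. -/
def bandedSubalgebra : Subalgebra 𝕜 (E →L[𝕜] E) where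
  carrier := {A | ∃ d : ℕ, ∀ m, ∀ x ∈ tail 𝕜 e m, A x ∈ tail 𝕜 e (m - d)}
  mul_mem' := by
    rintro A B ⟨d, hA⟩ ⟨d', hB⟩
    refine ⟨d + d', fun m x hx => ?_⟩
    have := hA _ _ (hB m x hx)
    rwa [sub_sub, add_comm, ← Nat.cast_add] at this
  add_mem' := by
    rintro A B ⟨d, hA⟩ ⟨d', hB⟩
    exact ⟨max d d', fun m x hx => add_mem (tail_anti (by push_cast; omega) (hA m x hx))
      (tail_anti (by push_cast; omega) (hB m x hx))⟩
  algebraMap_mem' c := ⟨0, fun m x hx => by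
    simpa [Algebra.algebraMap_eq_smul_one] using (tail 𝕜 e m).smul_mem c hx⟩

variable (𝕜 e) in
/-- The operators that are limits, in norm, of operators in `bandedSubalgebra`. -/
abbrev localSubalgebra : Subalgebra 𝕜 (E →L[𝕜] E) := (bandedSubalgebra 𝕜 e).topologicalClosure

theorem tailProj_mem_localSubalgebra (he : Orthonormal 𝕜 e) (k : ℤ) :
    tailProj 𝕜 e k ∈ localSubalgebra 𝕜 e := by
  refine Subalgebra.le_topologicalClosure _ ⟨0, fun m x hx => mem_tail.2 fun j hj => ?_⟩
  rcases lt_or_ge j k with hjk | hjk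
  · exact mem_tail.1 (Submodule.starProjection_apply_mem _ _) j hjk
  · rw [inner_tailProj he hjk]
    exact mem_tail.1 hx j (by simpa using hj)

end Tail

section Circle

theorem star_fourier {T : ℝ} (k : ℤ) : star (fourier k : C(AddCircle T, ℂ)) = fourier (-k) := by
  ext x
  rw [ContinuousMap.star_apply, fourier_neg, RCLike.star_def]

variable {T : ℝ} [Fact (0 < T)]

theorem mem_of_isClosed_of_fourier_mem {S : Submodule ℂ C(AddCircle T, ℂ)}
    (hS : IsClosed (S : Set C(AddCircle T, ℂ))) (h : ∀ k, fourier k ∈ S) (b : C(AddCircle T, ℂ)) :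
    b ∈ S := by
  have htop := Submodule.topologicalClosure_minimal _
    (Submodule.span_le.2 (Set.range_subset_iff.2 h)) hS
  rw [span_fourier_closure_eq_top] at htop
  exact htop Submodule.mem_top

/-- The square integrable functions on the circle of length `T`. -/
abbrev L2 (T : ℝ) [Fact (0 < T)] : Type := Lp ℂ 2 (haarAddCircle (T := T))

/-- The multiplication operators on `L²` of the circle. -/
abbrev circleMul : C(AddCircle T, ℂ) →ₐ[ℂ] (L2 T →L[ℂ] L2 T) := mulOp haarAddCircle 2

/-- The functions with frequencies at least `m`; for `m = 0` this is the Hardy space `H²`. -/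
abbrev hardy (T : ℝ) [Fact (0 < T)] (m : ℤ) : Submodule ℂ (L2 T) := tail ℂ (fourierLp 2) m

/-- The orthogonal projection onto the Hardy space. -/
abbrev rieszProj (T : ℝ) [Fact (0 < T)] : L2 T →L[ℂ] L2 T := tailProj ℂ (fourierLp 2) 0

/-- The norm limits of operators on `L²` that lower frequencies by a bounded amount. -/
abbrev localOps (T : ℝ) [Fact (0 < T)] : Subalgebra ℂ (L2 T →L[ℂ] L2 T) :=
  localSubalgebra ℂ (fourierLp 2)

theorem circleMul_fourier_fourierLp (k j : ℤ) :
    circleMul (fourier k) (fourierLp (T := T) 2 j) = fourierLp 2 (j + k) := by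
  refine Lp.ext ?_
  filter_upwards [coeFn_mulOp (fourier k) (fourierLp (T := T) 2 j), coeFn_fourierLp (T := T) 2 j,
    coeFn_fourierLp (T := T) 2 (j + k)] with t hmul hj hjk
  rw [hmul, hj, hjk, fourier_add, mul_comm]

theorem inner_fourierLp_circleMul_fourierLp (b : C(AddCircle T, ℂ)) (i j : ℤ) :
    inner ℂ (fourierLp (T := T) 2 i) (circleMul b (fourierLp 2 j)) = fourierCoeff b (i - j) := by
  rw [L2.inner_def, fourierCoeff]
  refine integral_congr_ae ?_
  filter_upwards [coeFn_mulOp b (fourierLp (T := T) 2 j), coeFn_fourierLp (T := T) 2 j,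
    coeFn_fourierLp (T := T) 2 i] with t hmul hj hi
  rw [hmul, hj, hi, neg_sub, sub_eq_add_neg, fourier_add, fourier_neg]
  simp only [RCLike.inner_apply, smul_eq_mul]
  ring

theorem circleMul_fourier_mem_hardy (k : ℤ) {m : ℤ} {x : L2 T} (hx : x ∈ hardy T m) :
    circleMul (fourier k) x ∈ hardy T (m + k) := by
  refine mem_tail.2 fun j hj => ?_
  rw [← inner_star_mulOp, star_fourier, circleMul_fourier_fourierLp]
  exact mem_tail.1 hx _ (by omega)

theorem circleMul_mem_localOps (b : C(AddCircle T, ℂ)) : circleMul b ∈ localOps T := by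
  refine mem_of_isClosed_of_fourier_mem
    (S := (Subalgebra.toSubmodule (localOps T)).comap circleMul.toLinearMap)
    ((Subalgebra.isClosed_topologicalClosure _).preimage continuous_mulOp) (fun k => ?_) b
  exact Subalgebra.le_topologicalClosure _
    ⟨k.natAbs, fun m x hx => tail_anti (by omega) (circleMul_fourier_mem_hardy k hx)⟩

/-- The continuous functions `p` with `p H² ⊆ H²`. -/
def analyticSubalgebra (T : ℝ) [Fact (0 < T)] : Subalgebra ℂ C(AddCircle T, ℂ) :=
  (invariantSubalgebra (hardy T 0)).comap circleMul

/-- The continuous functions `q` with `q (H²)ᗮ ⊆ (H²)ᗮ`. -/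
def coanalyticSubalgebra (T : ℝ) [Fact (0 < T)] : Subalgebra ℂ C(AddCircle T, ℂ) :=
  (invariantSubalgebra (hardy T 0)ᗮ).comap circleMul

theorem isClosed_coanalyticSubalgebra :
    IsClosed (coanalyticSubalgebra T : Set C(AddCircle T, ℂ)) :=
  (isClosed_invariantSubalgebra (V := (hardy T 0)ᗮ) (Submodule.isClosed_orthogonal _)).preimage
    (continuous_mulOp (𝕜 := ℂ) (μ := haarAddCircle) (p := 2))

theorem fourier_one_mem_analyticSubalgebra : fourier 1 ∈ analyticSubalgebra T := fun _ hx =>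
  tail_anti (by norm_num) (circleMul_fourier_mem_hardy 1 hx)

theorem fourier_neg_one_mem_coanalyticSubalgebra : fourier (-1) ∈ coanalyticSubalgebra T := by
  refine fun x hx => (Submodule.mem_orthogonal _ _).2 fun y hy => ?_
  change inner ℂ y (circleMul (fourier (-1)) x) = 0
  rw [← inner_star_mulOp, star_fourier, neg_neg]
  exact (Submodule.mem_orthogonal _ _).1 hx _ (fourier_one_mem_analyticSubalgebra _ hy)

theorem rieszProj_circleMul_rieszProj {q : C(AddCircle T, ℂ)} (hq : q ∈ coanalyticSubalgebra T)
    (x : L2 T) : rieszProj T (circleMul q (rieszProj T x)) = rieszProj T (circleMul q x) := by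
  have hmem := hq _ (Submodule.sub_starProjection_mem_orthogonal (K := hardy T 0) x)
  have hzero := (Submodule.starProjection_apply_eq_zero_iff (hardy T 0)).2 hmem
  change rieszProj T (circleMul q (x - rieszProj T x)) = 0 at hzero
  rw [map_sub, map_sub, sub_eq_zero] at hzero
  exact hzero.symm

end Circle

section EvenFunctions

variable {T : ℝ}

/-- The function `t + t⁻¹` on the circle. -/
def tau (T : ℝ) : C(AddCircle T, ℂ) := fourier 1 + fourier (-1)

theorem fourier_mul_fourier_neg (k : ℤ) : (fourier k * fourier (-k) : C(AddCircle T, ℂ)) = 1 := by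
  ext x
  rw [ContinuousMap.mul_apply, ← fourier_add]
  simp

theorem tau_apply (x : AddCircle T) : tau T x = (toCircle x : ℂ) + (toCircle x : ℂ)⁻¹ := by
  rw [tau, ContinuousMap.add_apply, fourier_neg, fourier_one, ← Circle.coe_inv_eq_conj,
    Circle.coe_inv]

theorem aeval_chebyshevC_tau (k : ℤ) :
    Polynomial.aeval (tau T) (Polynomial.Chebyshev.C ℂ k) = fourier k + fourier (-k) := by
  have htau (k : ℤ) (x : AddCircle T) : tau T x * (fourier k x + fourier (-k) x) =
      (fourier (k + 1) x + fourier (-(k + 1)) x) + (fourier (k - 1) x + fourier (-(k - 1)) x) := by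
    rw [show -(k + 1) = -k + -1 by ring, show -(k - 1) = -k + 1 by ring, sub_eq_add_neg,
      fourier_add, fourier_add, fourier_add, fourier_add, tau, ContinuousMap.add_apply]
    ring
  ext x
  induction k using Polynomial.Chebyshev.induct with
  | zero => norm_num
  | one => simp [tau]
  | add_two n ih₁ ih₀ =>
    rw [Polynomial.Chebyshev.C_add_two, map_sub, map_mul, Polynomial.aeval_X,
      ContinuousMap.sub_apply, ContinuousMap.mul_apply, ih₁, ih₀]
    have h := htau (n + 1) x
    rw [add_sub_cancel_right, add_assoc (n : ℤ) 1 1, one_add_one_eq_two] at h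
    simp only [ContinuousMap.add_apply]
    linear_combination h
  | neg_add_one n ih₁ ih₀ =>
    rw [Polynomial.Chebyshev.C_sub_one, map_sub, map_mul, Polynomial.aeval_X,
      ContinuousMap.sub_apply, ContinuousMap.mul_apply, ih₁, ih₀]
    simp only [ContinuousMap.add_apply]
    linear_combination htau (-n) x

theorem mem_closure_adjoin_tau_of_even [Fact (0 < T)] {b : C(AddCircle T, ℂ)}
    (hb : ∀ x, b (-x) = b x) : b ∈ (Algebra.adjoin ℂ {tau T}).topologicalClosure := by
  let neg : C(AddCircle T, AddCircle T) := ⟨Neg.neg, continuous_neg⟩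
  let symmetrize : C(AddCircle T, ℂ) →ₗ[ℂ] C(AddCircle T, ℂ) :=
    LinearMap.id + (ContinuousMap.compRightAlgHom ℂ ℂ neg).toLinearMap
  have happly (b : C(AddCircle T, ℂ)) (x : AddCircle T) : symmetrize b x = b x + b (-x) := rfl
  have hcont : Continuous symmetrize := continuous_id.add (ContinuousMap.continuous_precomp neg)
  have hmem : symmetrize b ∈ (Algebra.adjoin ℂ {tau T}).topologicalClosure := by
    refine mem_of_isClosed_of_fourier_mem (S := (Subalgebra.toSubmodule
      (Algebra.adjoin ℂ {tau T}).topologicalClosure).comap symmetrize)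
      ((Subalgebra.isClosed_topologicalClosure _).preimage hcont) (fun k => ?_) b
    have hk : symmetrize (fourier k) = fourier k + fourier (-k) := by
      ext x
      simp [happly, fourier_apply]
    rw [Submodule.mem_comap, hk, ← aeval_chebyshevC_tau]
    exact Subalgebra.le_topologicalClosure _ (Polynomial.aeval_mem_adjoin_singleton ℂ _)
  have hsymm : (2 : ℂ)⁻¹ • symmetrize b = b := by
    ext x
    rw [ContinuousMap.smul_apply, happly, hb, smul_eq_mul]
    ring
  rw [← hsymm]
  exact Subalgebra.smul_mem _ hmem _

theorem fourierCoeff_neg_of_even {b : AddCircle T → ℂ} [Fact (0 < T)] (hb : ∀ x, b (-x) = b x)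
    (j : ℤ) : fourierCoeff b (-j) = fourierCoeff b j := by
  rw [fourierCoeff, fourierCoeff, ← integral_neg_eq_self]
  refine integral_congr_ae (.of_forall fun x => ?_)
  simp only [hb, fourier_apply, neg_neg, neg_smul, smul_neg]

end EvenFunctions

section Factorization

theorem tau_sub_algebraMap_add_inv {T : ℝ} {w : ℂ} (hw : w ≠ 0) :
    tau T - algebraMap ℂ _ (w + w⁻¹) =
      algebraMap ℂ _ (-w⁻¹) * ((1 - w • fourier (-1)) * (1 - w • fourier 1)) := by
  ext x
  have hfourier : fourier 1 x * fourier (-1) x = 1 :=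
    DFunLike.congr_fun (fourier_mul_fourier_neg (T := T) 1) x
  simp only [tau, ContinuousMap.sub_apply, ContinuousMap.add_apply, ContinuousMap.mul_apply,
    ContinuousMap.smul_apply, ContinuousMap.one_apply, algebraMap_apply, smul_eq_mul]
  field_simp
  linear_combination w ^ 2 * hfourier

theorem exists_eq_add_inv (ρ : ℂ) : ∃ w : ℂ, w ≠ 0 ∧ ρ = w + w⁻¹ := by
  obtain ⟨δ, hδ⟩ := IsAlgClosed.exists_pow_nat_eq (ρ ^ 2 - 4) (n := 2) (by norm_num)
  have hw : (ρ + δ) / 2 * ((ρ - δ) / 2) = 1 := by linear_combination -hδ / 4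
  refine ⟨(ρ + δ) / 2, left_ne_zero_of_mul_eq_one hw, ?_⟩
  rw [inv_eq_of_mul_eq_one_right hw]
  ring

variable (T : ℝ) [hT : Fact (0 < T)]

/-- The symbols `q p` with a Wiener–Hopf factorization: `p` is an invertible analytic function and
`q` an invertible function with coanalytic inverse. -/
def wienerHopf : Submonoid C(AddCircle T, ℂ) where
  carrier := {b | ∃ p q : C(AddCircle T, ℂ)ˣ, (p : C(AddCircle T, ℂ)) ∈ analyticSubalgebra T ∧
    (↑q⁻¹ : C(AddCircle T, ℂ)) ∈ coanalyticSubalgebra T ∧ b = q * p}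
  one_mem' := ⟨1, 1, one_mem _, by rw [inv_one]; exact one_mem _, (one_mul _).symm⟩
  mul_mem' := by
    rintro _ _ ⟨p, q, hp, hq, rfl⟩ ⟨p', q', hp', hq', rfl⟩
    refine ⟨p * p', q * q', mul_mem hp hp', ?_, ?_⟩
    · rw [mul_inv]
      exact mul_mem hq hq'
    · push_cast
      ring

variable {T}

theorem algebraMap_mem_wienerHopf {c : ℂ} (hc : c ≠ 0) :
    algebraMap ℂ C(AddCircle T, ℂ) c ∈ wienerHopf T :=
  ⟨Units.map (algebraMap ℂ C(AddCircle T, ℂ)).toMonoidHom (Units.mk0 c hc), 1,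
    Subalgebra.algebraMap_mem _ c, by rw [inv_one]; exact one_mem _, (one_mul _).symm⟩

theorem tau_sub_mem_wienerHopf_of_norm_lt_one {w : ℂ} (hw : w ≠ 0) (hw1 : ‖w‖ < 1) :
    tau T - algebraMap ℂ _ (w + w⁻¹) ∈ wienerHopf T := by
  have hnorm (k : ℤ) : ‖w • fourier (T := T) k‖ < 1 := by rwa [norm_smul, fourier_norm, mul_one]
  rw [tau_sub_algebraMap_add_inv hw]
  refine mul_mem (algebraMap_mem_wienerHopf (neg_ne_zero.2 (inv_ne_zero hw)))
    ⟨Units.oneSub _ (hnorm 1), Units.oneSub _ (hnorm (-1)), ?_, ?_, rfl⟩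
  · exact sub_mem (one_mem _) (Subalgebra.smul_mem _ fourier_one_mem_analyticSubalgebra w)
  · exact tsum_pow_mem_of_isClosed isClosed_coanalyticSubalgebra
      (Subalgebra.smul_mem _ fourier_neg_one_mem_coanalyticSubalgebra w) (hnorm (-1))

theorem tau_sub_mem_wienerHopf {ρ : ℂ} (h : IsUnit (tau T - algebraMap ℂ _ ρ)) :
    tau T - algebraMap ℂ _ ρ ∈ wienerHopf T := by
  obtain ⟨w, hw, rfl⟩ := exists_eq_add_inv ρ
  rcases lt_trichotomy ‖w‖ 1 with hw1 | hw1 | hw1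
  · exact tau_sub_mem_wienerHopf_of_norm_lt_one hw hw1
  · obtain ⟨x, hx⟩ := (AddCircle.homeomorphCircle hT.out.ne').surjective
      ⟨w, mem_sphere_zero_iff_norm.2 hw1⟩
    rw [AddCircle.homeomorphCircle_apply] at hx
    refine absurd ?_ ((ContinuousMap.isUnit_iff_forall_ne_zero _).1 h x)
    rw [ContinuousMap.sub_apply, tau_apply, hx]
    simp
  · have := tau_sub_mem_wienerHopf_of_norm_lt_one (T := T) (inv_ne_zero hw)
      (by rw [norm_inv]; exact inv_lt_one_of_one_lt₀ hw1)
    rwa [inv_inv, add_comm] at this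

theorem mem_wienerHopf_of_mem_adjoin_tau {b : C(AddCircle T, ℂ)}
    (hb : b ∈ Algebra.adjoin ℂ {tau T}) (h : IsUnit b) : b ∈ wienerHopf T := by
  rw [Algebra.adjoin_singleton_eq_range_aeval] at hb
  obtain ⟨P, rfl⟩ := hb
  have hfactor : Polynomial.aeval (tau T) P = algebraMap ℂ _ P.leadingCoeff *
      (P.roots.map fun ρ => tau T - algebraMap ℂ C(AddCircle T, ℂ) ρ).prod := by
    conv_lhs => rw [(IsAlgClosed.splits P).eq_prod_roots]
    rw [map_mul, Polynomial.aeval_C, map_multiset_prod, Multiset.map_map]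
    simp
  have hP : P.leadingCoeff ≠ 0 := by
    rw [Polynomial.leadingCoeff_ne_zero]
    rintro rfl
    simp at h
  rw [AlgHom.toRingHom_eq_coe, RingHom.coe_coe, hfactor] at h ⊢
  refine mul_mem (algebraMap_mem_wienerHopf hP) (multiset_prod_mem _ fun c hc => ?_)
  have hunit : IsUnit c := isUnit_of_dvd_unit (Multiset.dvd_prod hc) (isUnit_of_mul_isUnit_right h)
  obtain ⟨ρ, -, rfl⟩ := Multiset.mem_map.1 hc
  exact tau_sub_mem_wienerHopf hunit

theorem exists_eq_mul_one_sub {𝓐 : Type*} [NormedCommRing 𝓐] [HasSummableGeomSeries 𝓐] {S : Set 𝓐}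
    {b : 𝓐} (hb : b ∈ closure S) (h : IsUnit b) :
    ∃ c ∈ S, IsUnit c ∧ ∃ ε : 𝓐, ‖ε‖ < 1 ∧ b = c * (1 - ε) := by
  have hlim : Tendsto (fun c => 1 - b * Ring.inverse c) (𝓝 b) (𝓝 0) := by
    have := tendsto_const_nhds (x := (1 : 𝓐)).sub
      ((NormedRing.inverse_continuousAt h.unit).tendsto.const_mul b)
    simp only [IsUnit.unit_spec] at this
    rwa [Ring.mul_inverse_cancel _ h, sub_self] at this
  have hnear := (hlim.norm.eventually_lt_const (u := 1) (by simp)).and (Units.nhds h.unit)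
  obtain ⟨c, hcS, hc1, hc⟩ := (mem_closure_iff_frequently.1 hb).and_eventually hnear |>.exists
  refine ⟨c, hcS, hc, 1 - b * Ring.inverse c, hc1, ?_⟩
  rw [sub_sub_cancel, mul_left_comm, Ring.mul_inverse_cancel _ hc, mul_one]

/-- `G` is a left inverse of the Toeplitz operator of `b` on the Hardy space. -/
def IsToeplitzLeftInverse (G : L2 T →L[ℂ] L2 T) (b : C(AddCircle T, ℂ)) : Prop :=
  ∀ x ∈ hardy T 0, G (rieszProj T (circleMul b x)) = x

theorem exists_leftInverse_of_mem_wienerHopf {c ε : C(AddCircle T, ℂ)} (hc : c ∈ wienerHopf T)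
    (hε : ‖ε‖ < 1) : ∃ G ∈ localOps T, IsToeplitzLeftInverse G (c * (1 - ε)) := by
  obtain ⟨p, q, hp, hq, rfl⟩ := hc
  have hmem (b : C(AddCircle T, ℂ)) : circleMul b ∈ localOps T := circleMul_mem_localOps b
  have hproj : rieszProj T ∈ localOps T := tailProj_mem_localSubalgebra orthonormal_fourier 0
  set A := rieszProj T * circleMul ε * rieszProj T with hA
  have hA1 : ‖A‖ < 1 := by
    have hQ : ‖rieszProj T‖ ≤ 1 := Submodule.starProjection_norm_le _
    calc ‖A‖ ≤ ‖rieszProj T‖ * ‖circleMul ε‖ * ‖rieszProj T‖ :=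
          (norm_mul_le _ _).trans (by gcongr; exact norm_mul_le _ _)
      _ ≤ 1 * ‖ε‖ * 1 := by gcongr; exact norm_mulOp_le ε
      _ < 1 := by simpa using hε
  refine ⟨circleMul ↑p⁻¹ * (∑' n : ℕ, A ^ n) * (rieszProj T * circleMul ↑q⁻¹),
    mul_mem (mul_mem (hmem _) (tsum_pow_mem_of_isClosed (Subalgebra.isClosed_topologicalClosure _)
      (mul_mem (mul_mem hproj (hmem ε)) hproj) hA1)) (mul_mem hproj (hmem _)), fun x hx => ?_⟩
  have hpx : rieszProj T (circleMul (p : C(AddCircle T, ℂ)) x) = circleMul ↑p x :=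
    Submodule.starProjection_eq_self_iff.2 (hp x hx)
  have hcancel_q : rieszProj T (circleMul ↑q⁻¹ (rieszProj T
      (circleMul (q.val * p.val * (1 - ε)) x))) = (1 - A) (circleMul ↑p x) := by
    have hqp : ↑q⁻¹ * (q.val * p.val * (1 - ε)) = p - ε * p := by
      rw [mul_assoc, Units.inv_mul_cancel_left]
      ring
    rw [rieszProj_circleMul_rieszProj hq, mulOp_mulOp_apply, hqp, map_sub, sub_apply, map_sub,
      hpx, ← mulOp_mulOp_apply, sub_apply, hA]
    simp only [mul_apply_eq_comp, one_apply_eq_self, hpx]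
  have hcancel_A : (∑' n : ℕ, A ^ n) ((1 - A) (circleMul ↑p x)) = circleMul ↑p x := by
    rw [← mul_apply_eq_comp (∑' n : ℕ, A ^ n), geom_series_mul_neg A hA1, one_apply_eq_self]
  simp only [mul_apply_eq_comp]
  rw [hcancel_q, hcancel_A, mulOp_mulOp_apply, Units.inv_mul, map_one, one_apply_eq_self]

theorem exists_leftInverse_of_even {b : C(AddCircle T, ℂ)} (hb : ∀ x, b (-x) = b x)
    (h : IsUnit b) : ∃ G ∈ localOps T, IsToeplitzLeftInverse G b := by
  obtain ⟨c, hc, hcu, ε, hε, rfl⟩ := exists_eq_mul_one_sub (mem_closure_adjoin_tau_of_even hb) h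
  exact exists_leftInverse_of_mem_wienerHopf (mem_wienerHopf_of_mem_adjoin_tau hc hcu) hε

end Factorization

section FiniteSection

variable {𝕜 E : Type*} [RCLike 𝕜] [NormedAddCommGroup E] [InnerProductSpace 𝕜 E] {e : ℤ → E}

/-- The isometric embedding of `𝕜^N` that maps the standard basis to `e 0, …, e (N - 1)`. -/
def embed (he : Orthonormal 𝕜 e) (N : ℕ) : EuclideanSpace 𝕜 (Fin N) →ₗᵢ[𝕜] E :=
  ((EuclideanSpace.basisFun (Fin N) 𝕜).toBasis.constr 𝕜 fun k => e k).isometryOfOrthonormal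
    (v := (EuclideanSpace.basisFun (Fin N) 𝕜).toBasis)
    (by simp)
    (by
      convert he.comp (fun k : Fin N => (k : ℤ)) (Nat.cast_injective.comp Fin.val_injective)
      simp [Function.comp_def])

variable (he : Orthonormal 𝕜 e) {N : ℕ}

theorem embed_apply (x : EuclideanSpace 𝕜 (Fin N)) : embed he N x = ∑ k, x k • e k :=
  Module.Basis.constr_apply_fintype _ _ _ _

theorem inner_embed (x : EuclideanSpace 𝕜 (Fin N)) (k : Fin N) :
    inner 𝕜 (e k) (embed he N x) = x k := by
  rw [embed_apply]
  exact (he.comp _ (Nat.cast_injective.comp Fin.val_injective)).inner_right_fintype x k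

theorem embed_mem_tail (x : EuclideanSpace 𝕜 (Fin N)) : embed he N x ∈ tail 𝕜 e 0 := by
  rw [embed_apply]
  exact sum_mem fun k _ =>
    Submodule.smul_mem _ _ (mem_tail_of_orthonormal he (Int.natCast_nonneg k))

variable [CompleteSpace E]

variable (N) in
/-- The `N × N` finite section `(⟪e i, A (e j)⟫)` of `A`. -/
def finiteSection : (E →L[𝕜] E) →ₗ[𝕜]
    EuclideanSpace 𝕜 (Fin N) →L[𝕜] EuclideanSpace 𝕜 (Fin N) where
  toFun A := (embed he N).toContinuousLinearMap.adjoint ∘L A ∘L (embed he N).toContinuousLinearMap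
  map_add' _ _ := by simp
  map_smul' _ _ := by simp

theorem finiteSection_apply (A : E →L[𝕜] E) (x : EuclideanSpace 𝕜 (Fin N)) (k : Fin N) :
    finiteSection he N A x k = inner 𝕜 (e k) (A (embed he N x)) := by
  calc finiteSection he N A x k
      = inner 𝕜 (EuclideanSpace.single k 1) (finiteSection he N A x) := by
        rw [EuclideanSpace.inner_single_left, map_one, one_mul]
    _ = inner 𝕜 (embed he N (EuclideanSpace.single k 1)) (A (embed he N x)) :=
        ContinuousLinearMap.adjoint_inner_right (embed he N).toContinuousLinearMap _ _
    _ = inner 𝕜 (e k) (A (embed he N x)) := by simp [embed_apply]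

theorem norm_finiteSection_le (A : E →L[𝕜] E) : ‖finiteSection he N A‖ ≤ ‖A‖ := by
  set V := (embed he N).toContinuousLinearMap
  have hV : ‖V‖ ≤ 1 := (embed he N).norm_toContinuousLinearMap_le
  calc ‖V.adjoint ∘L A ∘L V‖
      ≤ ‖V.adjoint‖ * (‖A‖ * ‖V‖) :=
        (ContinuousLinearMap.opNorm_comp_le _ _).trans
          (by gcongr; exact ContinuousLinearMap.opNorm_comp_le _ _)
    _ ≤ 1 * (‖A‖ * 1) := by
        rw [LinearIsometryEquiv.norm_map]
        gcongr
    _ = ‖A‖ := by ring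

theorem tailProj_sub_embed_finiteSection_mem_tail (A : E →L[𝕜] E)
    (x : EuclideanSpace 𝕜 (Fin N)) :
    tailProj 𝕜 e 0 (A (embed he N x)) - embed he N (finiteSection he N A x) ∈ tail 𝕜 e N := by
  refine mem_tail.2 fun j hj => ?_
  rw [inner_sub_right, sub_eq_zero]
  rcases lt_or_ge j 0 with hj0 | hj0
  · rw [mem_tail.1 (Submodule.starProjection_apply_mem _ _) j hj0,
      mem_tail.1 (embed_mem_tail he _) j hj0]
  · lift j to ℕ using hj0
    rw [inner_tailProj he (by positivity)]
    exact ((inner_embed he _ ⟨j, by simpa using hj⟩).trans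
      (finiteSection_apply he A x ⟨j, by simpa using hj⟩)).symm

theorem norm_tailProj_sub_embed_finiteSection_le (A : E →L[𝕜] E)
    (x : EuclideanSpace 𝕜 (Fin N)) :
    ‖tailProj 𝕜 e 0 (A (embed he N x)) - embed he N (finiteSection he N A x)‖ ≤
      2 * ‖A‖ * ‖x‖ := by
  have hproj : ‖tailProj 𝕜 e 0 (A (embed he N x))‖ ≤ ‖A‖ * ‖x‖ :=
    (Submodule.norm_starProjection_apply_le _ _).trans (by simpa using A.le_opNorm (embed he N x))
  have hsection : ‖embed he N (finiteSection he N A x)‖ ≤ ‖A‖ * ‖x‖ := by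
    rw [LinearIsometry.norm_map]
    exact (finiteSection he N A).le_of_opNorm_le (norm_finiteSection_le he A) x
  linarith [norm_sub_le_of_le hproj hsection]

theorem exists_sum_initial_le {A G : E →L[𝕜] E} (hG : G ∈ localSubalgebra 𝕜 e)
    (hGA : ∀ x ∈ tail 𝕜 e 0, G (tailProj 𝕜 e 0 (A x)) = x) {η : ℝ} (hη : 0 < η) :
    ∃ (D : ℕ) (K : ℝ≥0), ∀ (N : ℕ) (x : EuclideanSpace 𝕜 (Fin N)),
      ∑ k ∈ {k : Fin N | (k : ℕ) + D < N}, ‖x k‖ ^ 2 ≤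
        (K * ‖finiteSection he N A x‖ + η * ‖x‖) ^ 2 := by
  obtain ⟨B, ⟨D, hB⟩, hGB⟩ := Metric.mem_closure_iff.1 hG (η / (2 * ‖A‖ + 1)) (by positivity)
  rw [dist_eq_norm] at hGB
  refine ⟨D, ‖G‖₊, fun N x => ?_⟩
  set r := finiteSection he N A x
  set w := tailProj 𝕜 e 0 (A (embed he N x)) - embed he N r with hw
  have hsplit : embed he N x - B w = G (embed he N r) + (G - B) w := by
    have hx := hGA _ (embed_mem_tail he x)
    rw [← sub_add_cancel (tailProj 𝕜 e 0 (A (embed he N x))) (embed he N r), ← hw, map_add] at hx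
    rw [sub_apply, ← hx]
    abel
  -- `w` has no frequencies below `N`, and `B` lowers frequencies by at most `D`.
  have hcoord (k : Fin N) (hk : (k : ℕ) + D < N) : inner 𝕜 (e k) (embed he N x - B w) = x k := by
    have hBw := mem_tail.1 (hB N w (tailProj_sub_embed_finiteSection_mem_tail he A x)) k (by omega)
    rw [inner_sub_right, hBw, sub_zero, inner_embed]
  have hw_le : ‖w‖ ≤ (2 * ‖A‖ + 1) * ‖x‖ :=
    (norm_tailProj_sub_embed_finiteSection_le he A x).trans (by gcongr; linarith)
  have hnorm : ‖embed he N x - B w‖ ≤ ‖G‖ * ‖r‖ + η * ‖x‖ := by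
    rw [hsplit]
    calc ‖G (embed he N r) + (G - B) w‖ ≤ ‖G‖ * ‖embed he N r‖ + ‖G - B‖ * ‖w‖ :=
          norm_add_le_of_le (G.le_opNorm _) ((G - B).le_opNorm w)
      _ ≤ ‖G‖ * ‖r‖ + η / (2 * ‖A‖ + 1) * ((2 * ‖A‖ + 1) * ‖x‖) := by
          rw [LinearIsometry.norm_map]
          gcongr
      _ = ‖G‖ * ‖r‖ + η * ‖x‖ := by field_simp
  have hinj : Function.Injective fun k : Fin N => (k : ℤ) :=
    Nat.cast_injective.comp Fin.val_injective
  calc ∑ k ∈ {k : Fin N | (k : ℕ) + D < N}, ‖x k‖ ^ 2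
      = ∑ k ∈ {k : Fin N | (k : ℕ) + D < N}, ‖inner 𝕜 (e k) (embed he N x - B w)‖ ^ 2 :=
        Finset.sum_congr rfl fun k hk => by rw [hcoord k (Finset.mem_filter.1 hk).2]
    _ ≤ ‖embed he N x - B w‖ ^ 2 := (he.comp _ hinj).sum_inner_products_le _
    _ ≤ (‖G‖ * ‖r‖ + η * ‖x‖) ^ 2 := by gcongr

/-- The reversal of the coordinates. -/
abbrev reversal (𝕜 : Type*) [RCLike 𝕜] (N : ℕ) :
    EuclideanSpace 𝕜 (Fin N) ≃ₗᵢ[𝕜] EuclideanSpace 𝕜 (Fin N) :=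
  LinearIsometryEquiv.piLpCongrLeft 2 𝕜 𝕜 Fin.revPerm

theorem reversal_apply (x : EuclideanSpace 𝕜 (Fin N)) (k : Fin N) :
    reversal 𝕜 N x k = x k.rev := rfl

theorem norm_sq_le_sum_initial_add {D : ℕ} (hN : 2 * D ≤ N) (x : EuclideanSpace 𝕜 (Fin N)) :
    ‖x‖ ^ 2 ≤ ∑ k ∈ {k : Fin N | (k : ℕ) + D < N}, ‖x k‖ ^ 2 +
      ∑ k ∈ {k : Fin N | (k : ℕ) + D < N}, ‖reversal 𝕜 N x k‖ ^ 2 := by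
  rw [EuclideanSpace.norm_sq_eq, Finset.sum_filter, Finset.sum_filter,
    ← Equiv.sum_comp Fin.revPerm fun k : Fin N =>
      if (k : ℕ) + D < N then ‖reversal 𝕜 N x k‖ ^ 2 else 0,
    ← Finset.sum_add_distrib]
  refine Finset.sum_le_sum fun k _ => ?_
  rw [Fin.revPerm_apply, reversal_apply, Fin.rev_rev, Fin.val_rev]
  split_ifs <;> first | omega | simp

theorem exists_antilipschitzWith_finiteSection {A G : E →L[𝕜] E} (hG : G ∈ localSubalgebra 𝕜 e)
    (hGA : ∀ x ∈ tail 𝕜 e 0, G (tailProj 𝕜 e 0 (A x)) = x)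
    (hA : ∀ (N : ℕ) x, finiteSection he N A (reversal 𝕜 N x) =
      reversal 𝕜 N (finiteSection he N A x)) :
    ∃ (N₀ : ℕ) (K : ℝ≥0), ∀ N ≥ N₀, AntilipschitzWith K (finiteSection he N A) := by
  obtain ⟨D, K, hK⟩ := exists_sum_initial_le he hG hGA (η := 1 / 4) (by norm_num)
  refine ⟨2 * D, 4 * K, fun N hN => AddMonoidHomClass.antilipschitz_of_bound _ fun x => ?_⟩
  have hrev := hK N (reversal 𝕜 N x)
  rw [hA, LinearIsometryEquiv.norm_map, LinearIsometryEquiv.norm_map] at hrev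
  set R := K * ‖finiteSection he N A x‖ + 1 / 4 * ‖x‖ with hR
  have hle : ‖x‖ ≤ 2 * R := by
    have hsq : ‖x‖ ^ 2 ≤ R ^ 2 + R ^ 2 :=
      (norm_sq_le_sum_initial_add hN x).trans (add_le_add (hK N x) hrev)
    refine (sq_le_sq₀ (norm_nonneg _) (by positivity)).1 (hsq.trans ?_)
    linarith [sq_nonneg R]
  push_cast
  linarith

theorem eventually_antilipschitzWith_finiteSection {A : E →L[𝕜] E} {N₀ : ℕ} {K : ℝ≥0}
    (hA : ∀ N ≥ N₀, AntilipschitzWith K (finiteSection he N A)) :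
    ∃ K', ∀ᶠ B in 𝓝 A, ∀ N ≥ N₀, AntilipschitzWith K' (finiteSection he N B) := by
  have hlt : (2 * (K + 1))⁻¹ < (K + 1)⁻¹ := by
    rw [mul_inv]
    exact mul_lt_of_lt_one_left (by positivity) (by norm_num)
  refine ⟨((K + 1)⁻¹ - (2 * (K + 1))⁻¹)⁻¹, ?_⟩
  filter_upwards [eventually_nnnorm_sub_lt A (ε := (2 * (K + 1))⁻¹) (by positivity)] with B hB N hN
  have hlip : LipschitzWith (2 * (K + 1))⁻¹ (finiteSection he N (B - A)) :=
    (finiteSection he N (B - A)).lipschitz.weaken ((norm_finiteSection_le he _).trans hB.le)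
  have hK : AntilipschitzWith (K + 1) (finiteSection he N A) := fun x y =>
    (hA N hN x y).trans (by gcongr; exact le_self_add)
  simpa using hK.add_lipschitzWith hlip hlt

end FiniteSection

section Stability

theorem exists_eventually_nhdsSet_of_isCompact {X ι : Type*} [TopologicalSpace X] [Preorder ι]
    [IsDirectedOrder ι] [Nonempty ι] {P : ι → X → Prop} (hP : Monotone P) {𝒦 : Set X}
    (h𝒦 : IsCompact 𝒦) (h : ∀ x ∈ 𝒦, ∃ i, ∀ᶠ y in 𝓝 x, P i y) : ∃ i, ∀ᶠ y in 𝓝ˢ 𝒦, P i y := by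
  refine h𝒦.induction_on (p := fun s => ∃ i, ∀ᶠ y in 𝓝ˢ s, P i y) (by simp) ?_ ?_ fun x hx => ?_
  · rintro s t hst ⟨i, hi⟩
    exact ⟨i, hi.filter_mono (nhdsSet_mono hst)⟩
  · rintro s t ⟨i, hi⟩ ⟨j, hj⟩
    obtain ⟨k, hik, hjk⟩ := exists_ge_ge i j
    refine ⟨k, ?_⟩
    rw [nhdsSet_union, eventually_sup]
    exact ⟨hi.mono fun y => hP hik y, hj.mono fun y => hP hjk y⟩
  · obtain ⟨i, hi⟩ := h x hx
    exact ⟨_, mem_nhdsWithin_of_mem_nhds (eventually_eventually_nhds.2 hi), i,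
      eventually_nhdsSet_iff_forall.2 fun _ hy => hy⟩

theorem isUnit_and_norm_toEuclideanCLM_inv_le {𝕜 ι : Type*} [RCLike 𝕜] [Fintype ι] [DecidableEq ι]
    {A : Matrix ι ι 𝕜} {K : ℝ≥0} (hA : AntilipschitzWith K (Matrix.toEuclideanCLM (𝕜 := 𝕜) A)) :
    IsUnit A ∧ ‖Matrix.toEuclideanCLM (𝕜 := 𝕜) A⁻¹‖ ≤ K := by
  have hunit : IsUnit A := by
    rw [← Matrix.mulVec_injective_iff_isUnit]
    exact fun x y hxy => WithLp.toLp_injective 2 (hA.injective (congrArg (WithLp.toLp 2) hxy))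
  refine ⟨hunit, ContinuousLinearMap.opNorm_le_of_lipschitz (hA.to_rightInverse fun y => ?_)⟩
  rw [← mul_apply_eq_comp, ← map_mul,
    Matrix.mul_nonsing_inv _ ((Matrix.isUnit_iff_isUnit_det A).1 hunit), map_one,
    one_apply_eq_self]

theorem mulVec_comp_rev {R : Type*} [NonUnitalNonAssocSemiring R] {N : ℕ}
    {A : Matrix (Fin N) (Fin N) R} (hA : A.submatrix Fin.rev Fin.rev = A) (x : Fin N → R) :
    A.mulVec (x ∘ Fin.rev) = A.mulVec x ∘ Fin.rev := by
  conv_lhs => rw [← hA]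
  exact (Matrix.submatrix_mulVec_equiv A (x ∘ Fin.rev) Fin.rev Fin.revPerm).trans
    (by simp [Function.comp_assoc, Fin.revPerm, Fin.rev_involutive.comp_self])

variable {T : ℝ} [Fact (0 < T)]

/-- The `N × N` Toeplitz matrix of a function on the circle of length `T`. -/
def fourierToeplitz (N : ℕ) (b : AddCircle T → ℂ) : Matrix (Fin N) (Fin N) ℂ :=
  Matrix.of fun i j => fourierCoeff b ((i : ℤ) - j)

theorem fourierToeplitz_submatrix_rev {b : AddCircle T → ℂ} (hb : ∀ x, b (-x) = b x) (N : ℕ) :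
    (fourierToeplitz N b).submatrix Fin.rev Fin.rev = fourierToeplitz N b := by
  ext i j
  simp only [fourierToeplitz, Matrix.submatrix_apply, Matrix.of_apply]
  rw [← fourierCoeff_neg_of_even hb, Fin.val_rev, Fin.val_rev]
  congr 1
  omega

theorem finiteSection_circleMul (b : C(AddCircle T, ℂ)) (N : ℕ) :
    finiteSection orthonormal_fourier N (circleMul b) =
      Matrix.toEuclideanCLM (𝕜 := ℂ) (fourierToeplitz N b) := by
  ext x i
  rw [finiteSection_apply, embed_apply, map_sum, inner_sum]
  simp only [map_smul, inner_smul_right, inner_fourierLp_circleMul_fourierLp]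
  simp only [Matrix.ofLp_toEuclideanCLM, Matrix.mulVec, dotProduct, fourierToeplitz,
    Matrix.of_apply, mul_comm]

theorem exists_antilipschitzWith_fourierToeplitz_of_even {b : C(AddCircle T, ℂ)}
    (hb : ∀ x, b (-x) = b x) (h : IsUnit b) :
    ∃ (N₀ : ℕ) (K : ℝ≥0), ∀ᶠ c : C(AddCircle T, ℂ) in 𝓝 b, ∀ N ≥ N₀,
      AntilipschitzWith K (Matrix.toEuclideanCLM (𝕜 := ℂ) (fourierToeplitz N c)) := by
  obtain ⟨G, hG, hGb⟩ := exists_leftInverse_of_even hb h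
  obtain ⟨N₀, K, hK⟩ := exists_antilipschitzWith_finiteSection orthonormal_fourier hG hGb
    fun N x => by
      rw [finiteSection_circleMul]
      exact WithLp.ofLp_injective 2 (mulVec_comp_rev (fourierToeplitz_submatrix_rev hb N) x.ofLp)
  obtain ⟨K', hK'⟩ := eventually_antilipschitzWith_finiteSection orthonormal_fourier hK
  refine ⟨N₀, K', ?_⟩
  filter_upwards [(continuous_mulOp (𝕜 := ℂ) (μ := haarAddCircle) (p := 2)).tendsto b hK']
    with c hc N hN
  rw [← finiteSection_circleMul]
  exact hc N hN

theorem exists_antilipschitzWith_fourierToeplitz_of_isCompact {𝒦 : Set C(AddCircle T, ℂ)}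
    (h𝒦 : IsCompact 𝒦) (heven : ∀ b ∈ 𝒦, ∀ x, b (-x) = b x) (hunit : ∀ b ∈ 𝒦, IsUnit b) :
    ∃ (N₀ : ℕ) (K : ℝ≥0), ∀ᶠ c : C(AddCircle T, ℂ) in 𝓝ˢ 𝒦, ∀ N ≥ N₀,
      AntilipschitzWith K (Matrix.toEuclideanCLM (𝕜 := ℂ) (fourierToeplitz N c)) := by
  have hmono : Monotone fun (q : ℕ × ℝ≥0) (c : C(AddCircle T, ℂ)) => ∀ N ≥ q.1,
      AntilipschitzWith q.2 (Matrix.toEuclideanCLM (𝕜 := ℂ) (fourierToeplitz N c)) :=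
    fun p q hpq c hc N hN x y => (hc N (hpq.1.trans hN) x y).trans (by gcongr; exact hpq.2)
  obtain ⟨⟨N₀, K⟩, hK⟩ := exists_eventually_nhdsSet_of_isCompact hmono h𝒦 fun b hb => by
    obtain ⟨N₀, K, hK⟩ := exists_antilipschitzWith_fourierToeplitz_of_even (heven b hb) (hunit b hb)
    exact ⟨(N₀, K), hK⟩
  exact ⟨N₀, K, hK⟩

end Stability

section DividedDifference

/-- The divided difference `(z^j + z⁻¹^j - w^j - w⁻¹^j) / (z + z⁻¹ - w - w⁻¹)`, written as a
Laurent polynomial so that its value at `w = z` and `w = z⁻¹` is the right one. -/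
def divDiff (j : ℕ) (z w : ℂ) : ℂ :=
  w ^ (j - 1) * (∑ k ∈ Finset.range j, (z * w⁻¹) ^ k) * ∑ k ∈ Finset.range j, (z⁻¹ * w⁻¹) ^ k

theorem add_inv_sub_mul_divDiff {z w : ℂ} (hz : z ≠ 0) (hw : w ≠ 0) (j : ℕ) :
    (z + z⁻¹ - (w + w⁻¹)) * divDiff j z w = z ^ j + z⁻¹ ^ j - (w ^ j + w⁻¹ ^ j) := by
  obtain _ | j := j
  · simp [divDiff]
  calc (z + z⁻¹ - (w + w⁻¹)) * divDiff (j + 1) z w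
      = w ^ (j + 1) * ((∑ k ∈ Finset.range (j + 1), (z * w⁻¹) ^ k) * (z * w⁻¹ - 1)) *
          ((∑ k ∈ Finset.range (j + 1), (z⁻¹ * w⁻¹) ^ k) * (1 - z⁻¹ * w⁻¹)) := by
        rw [divDiff, Nat.add_sub_cancel, pow_succ]
        field_simp
        ring
    _ = w ^ (j + 1) * ((z * w⁻¹) ^ (j + 1) - 1) * (1 - (z⁻¹ * w⁻¹) ^ (j + 1)) := by
        rw [geom_sum_mul, geom_sum_mul_neg]
    _ = z ^ (j + 1) + z⁻¹ ^ (j + 1) - (w ^ (j + 1) + w⁻¹ ^ (j + 1)) := by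
        simp only [mul_pow, inv_pow]
        field_simp
        ring

theorem divDiff_inv (j : ℕ) (z w : ℂ) : divDiff j z⁻¹ w = divDiff j z w := by
  rw [divDiff, divDiff, inv_inv, mul_right_comm]

theorem continuousAt_divDiff (j : ℕ) {z w : ℂ} (hz : z ≠ 0) (hw : w ≠ 0) :
    ContinuousAt (fun p : ℂ × ℂ => divDiff j p.1 p.2) (z, w) := by
  unfold divDiff
  fun_prop (disch := assumption)

/-- The closed annulus `q⁻¹ ≤ |z| ≤ q`. -/
def annulus (q : ℝ) : Set ℂ := {z | z ≠ 0 ∧ ‖z‖ ≤ q ∧ ‖z⁻¹‖ ≤ q}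

theorem one_le_of_mem_annulus {q : ℝ} {z : ℂ} (hz : z ∈ annulus q) : 1 ≤ q := by
  by_contra! hq
  have h : ‖z‖ * ‖z⁻¹‖ = 1 := by rw [← norm_mul, mul_inv_cancel₀ hz.1, norm_one]
  nlinarith [hz.2.1, hz.2.2, norm_nonneg z, norm_nonneg z⁻¹]

theorem coe_mem_annulus_one (z : Circle) : (z : ℂ) ∈ annulus 1 :=
  ⟨z.coe_ne_zero, z.norm_coe.le, by rw [norm_inv, z.norm_coe, inv_one]⟩

theorem inv_mem_annulus {q : ℝ} {z : ℂ} (hz : z ∈ annulus q) : z⁻¹ ∈ annulus q :=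
  ⟨inv_ne_zero hz.1, hz.2.2, by rw [inv_inv]; exact hz.2.1⟩

theorem annulus_mono {q r : ℝ} (hqr : q ≤ r) : annulus q ⊆ annulus r :=
  fun _ hz => ⟨hz.1, hz.2.1.trans hqr, hz.2.2.trans hqr⟩

theorem norm_geom_sum_le {q : ℝ} (hq : 1 ≤ q) {x : ℂ} (hx : ‖x‖ ≤ q) (j : ℕ) :
    ‖∑ k ∈ Finset.range j, x ^ k‖ ≤ j * q ^ j := by
  refine (norm_sum_le_of_le _ fun k hk => ?_).trans_eq
    (by rw [Finset.sum_const, Finset.card_range, nsmul_eq_mul])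
  rw [norm_pow]
  exact (pow_le_pow_left₀ (norm_nonneg _) hx k).trans
    (pow_le_pow_right₀ hq (Finset.mem_range.1 hk).le)

theorem norm_divDiff_le {q : ℝ} {z w : ℂ} (hz : z ∈ annulus q) (hw : w ∈ annulus q) (j : ℕ) :
    ‖divDiff j z w‖ ≤ (j : ℝ) ^ 2 * (q ^ j) ^ 5 := by
  have hq := one_le_of_mem_annulus hz
  have hmul {x y : ℂ} (hx : x ∈ annulus q) (hy : y ∈ annulus q) : ‖x * y‖ ≤ q ^ 2 := by
    rw [norm_mul, sq]
    exact mul_le_mul hx.2.1 hy.2.1 (norm_nonneg _) (by positivity)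
  have hsum {x y : ℂ} (hx : x ∈ annulus q) (hy : y ∈ annulus q) :=
    norm_geom_sum_le (one_le_pow₀ hq) (hmul hx hy) j
  have hpow : ‖w ^ (j - 1)‖ ≤ q ^ j := by
    rw [norm_pow]
    exact (pow_le_pow_left₀ (norm_nonneg _) hw.2.1 _).trans (pow_le_pow_right₀ hq (Nat.sub_le _ _))
  rw [divDiff, norm_mul, norm_mul]
  calc _ ≤ q ^ j * (j * (q ^ 2) ^ j) * (j * (q ^ 2) ^ j) := by
        gcongr
        exacts [hsum hz (inv_mem_annulus hw), hsum (inv_mem_annulus hz) (inv_mem_annulus hw)]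
    _ = (j : ℝ) ^ 2 * (q ^ j) ^ 5 := by ring

end DividedDifference

section DiffQuotient

/-- Minus the divided difference, with respect to `z + z⁻¹`, of the even Laurent series
`∑ j : ℤ, F j * z ^ j`. The sign is that of `b̂`. -/
def diffQuotient (F : ℤ → ℂ) (z w : ℂ) : ℂ := -∑' j : ℕ, F j * divDiff j z w

theorem diffQuotient_inv (F : ℤ → ℂ) (z w : ℂ) : diffQuotient F z⁻¹ w = diffQuotient F z w := by
  simp only [diffQuotient, divDiff_inv]

theorem hasSum_nat_of_even {F : ℤ → ℂ} (hF : ∀ j, F (-j) = F j) {z S : ℂ}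
    (h : HasSum (fun j => F j * z ^ j) S) :
    HasSum (fun j : ℕ => F j * (z ^ j + z⁻¹ ^ j)) (S + F 0) := by
  have h' := h.nat_add_neg
  simp only [hF, zpow_natCast, zpow_neg, zpow_zero, mul_one, ← mul_add, ← inv_pow] at h'
  exact h'

theorem sub_eq_mul_diffQuotient {F : ℤ → ℂ} (hF : ∀ j, F (-j) = F j) {z w S S' : ℂ}
    (hz : z ≠ 0) (hw : w ≠ 0) (hS : HasSum (fun j => F j * z ^ j) S)
    (hS' : HasSum (fun j => F j * w ^ j) S') :
    S - S' = (w + w⁻¹ - (z + z⁻¹)) * diffQuotient F z w := by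
  have h := (hasSum_nat_of_even hF hS).sub (hasSum_nat_of_even hF hS')
  rw [diffQuotient, mul_neg, ← neg_mul, neg_sub, ← tsum_mul_left, ← add_sub_add_right_eq_sub,
    ← h.tsum_eq]
  refine tsum_congr fun j => ?_
  rw [mul_left_comm, add_inv_sub_mul_divDiff hz hw, mul_sub]

theorem tendsto_diffQuotient {ι : Type*} {l : Filter ι} {F : ι → ℤ → ℂ} {F₀ : ℤ → ℂ}
    {z w : ι → ℂ} {z₀ w₀ : ℂ} {q : ι → ℝ} {B : ℕ → ℝ}
    (hB : Summable fun j : ℕ => B j * (j : ℝ) ^ 2)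
    (hFB : ∀ᶠ i in l, ∀ j : ℕ, ‖F i j‖ * (q i ^ j) ^ 5 ≤ B j)
    (hF : ∀ j : ℕ, Tendsto (fun i => F i j) l (𝓝 (F₀ j)))
    (hzq : ∀ᶠ i in l, z i ∈ annulus (q i)) (hwq : ∀ᶠ i in l, w i ∈ annulus (q i))
    (hz : Tendsto z l (𝓝 z₀)) (hw : Tendsto w l (𝓝 w₀)) (hz₀ : z₀ ≠ 0) (hw₀ : w₀ ≠ 0) :
    Tendsto (fun i => diffQuotient (F i) (z i) (w i)) l (𝓝 (diffQuotient F₀ z₀ w₀)) := by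
  refine (tendsto_tsum_of_dominated_convergence hB (fun j => (hF j).mul
    ((continuousAt_divDiff j hz₀ hw₀).tendsto.comp (hz.prodMk_nhds hw))) ?_).neg
  filter_upwards [hFB, hzq, hwq] with i hi hzi hwi j
  calc ‖F i j * divDiff j (z i) (w i)‖
      ≤ ‖F i j‖ * ((j : ℝ) ^ 2 * (q i ^ j) ^ 5) := by
        rw [norm_mul]
        gcongr
        exact norm_divDiff_le hzi hwi j
    _ = ‖F i j‖ * (q i ^ j) ^ 5 * (j : ℝ) ^ 2 := by ring
    _ ≤ B j * (j : ℝ) ^ 2 := by gcongr; exact hi j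

theorem continuousOn_diffQuotient {F : ℤ → ℂ} {q : ℝ}
    (hF : Summable fun j : ℕ => ‖F j‖ * (q ^ j) ^ 5 * (j : ℝ) ^ 2) :
    ContinuousOn (fun p : ℂ × ℂ => diffQuotient F p.1 p.2) (annulus q ×ˢ annulus q) := by
  intro p hp
  refine tendsto_diffQuotient (q := fun _ => q) hF (.of_forall fun _ _ => le_rfl)
    (fun _ => tendsto_const_nhds) ?_ ?_ (continuous_fst.continuousWithinAt)
    (continuous_snd.continuousWithinAt) hp.1.1 hp.2.1
  all_goals filter_upwards [self_mem_nhdsWithin] with r hr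
  exacts [hr.1, hr.2]

theorem continuous_diffQuotient_coe {F : ℤ → ℂ}
    (hF : Summable fun j : ℕ => ‖F j‖ * (j : ℝ) ^ 2) :
    Continuous fun p : Circle × Circle => diffQuotient F p.1 p.2 :=
  (continuousOn_diffQuotient (q := 1) (by simpa using hF)).comp_continuous
    (f := fun p : Circle × Circle => ((p.1 : ℂ), (p.2 : ℂ))) (by fun_prop)
    fun p => ⟨coe_mem_annulus_one p.1, coe_mem_annulus_one p.2⟩

end DiffQuotient

section ArcSymbol

instance fact_two_pi_pos : Fact (0 < 2 * Real.pi) := ⟨Real.two_pi_pos⟩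

theorem exists_mem_Icc_circleExp (z : Circle) :
    ∃ φ ∈ Set.Icc 0 Real.pi, z = Circle.exp φ ∨ z = (Circle.exp φ)⁻¹ := by
  obtain ⟨h₁, h₂⟩ := Complex.arg_mem_Ioc (z : ℂ)
  rcases le_total 0 (Complex.arg z) with h | h
  · exact ⟨Complex.arg z, ⟨h, h₂⟩, .inl (Circle.exp_arg z).symm⟩
  · refine ⟨-Complex.arg z, ⟨by linarith, by linarith⟩, .inr ?_⟩
    rw [Circle.exp_neg, inv_inv, Circle.exp_arg]

theorem exp_add_inv (φ : ℝ) :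
    (Circle.exp φ : ℂ) + (Circle.exp φ : ℂ)⁻¹ = ((2 * Real.cos φ : ℝ) : ℂ) := by
  rw [Circle.coe_exp, ← Complex.exp_neg, Complex.ofReal_mul, Complex.ofReal_cos, Complex.cos]
  push_cast
  ring_nf

theorem hasDerivAt_mul_of_eq_zero {h k : ℝ → ℂ} {h' : ℂ} {x : ℝ} (hh : HasDerivAt h h' x)
    (h0 : h x = 0) (hk : ContinuousAt k x) : HasDerivAt (fun y => h y * k y) (h' * k x) x := by
  rw [hasDerivAt_iff_tendsto_slope] at hh ⊢
  refine (hh.mul (hk.tendsto.mono_left nhdsWithin_le_nhds)).congr fun y => ?_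
  simp only [slope_def_module, h0, zero_mul, sub_zero, smul_mul_assoc]

variable {α : ℝ} {a : Circle → ℂ}

theorem MemCSL.mono {β : ℝ} (ha : MemCSL α a) (hβ : β ≤ α) : MemCSL β a where
  __ := ha
  memWiener := ⟨ha.memWiener.1, ha.memWiener.2.of_nonneg_of_le (fun _ => by positivity) fun j => by
    gcongr
    linarith [abs_nonneg (j : ℝ)]⟩

theorem MemCSL.apply_inv (ha : MemCSL α a) (z : Circle) : a z⁻¹ = a z := by
  have h {φ : ℝ} (hφ : φ ∈ Set.Icc 0 Real.pi) : a (Circle.exp φ)⁻¹ = a (Circle.exp φ) := by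
    have := ha.symm φ ⟨hφ.1, by linarith [hφ.1, hφ.2]⟩
    rw [g, g, Circle.exp_sub, Circle.exp_two_pi, one_div] at this
    exact this.symm
  obtain ⟨φ, hφ, rfl | rfl⟩ := exists_mem_Icc_circleExp z
  exacts [h hφ, by rw [inv_inv, h hφ]]

theorem MemCSL.coeff_neg (ha : MemCSL α a) (j : ℤ) : coeff a (-j) = coeff a j :=
  fourierCoeff_neg_of_even (fun x => by rw [toCircle_neg, ha.apply_inv]) j

theorem MemCSL.summable_coeff_mul_sq (ha : MemCSL 2 a) :
    Summable fun j : ℕ => ‖coeff a j‖ * (j : ℝ) ^ 2 := by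
  refine (ha.memWiener.2.comp_injective Nat.cast_injective).of_nonneg_of_le
    (fun j => by positivity) fun j => ?_
  simp only [Function.comp_apply, Int.cast_natCast, Nat.abs_cast, Real.rpow_ofNat]
  gcongr
  linarith

theorem MemCSL.summable_coeff (ha : MemCSL 2 a) : Summable (coeff a) := by
  refine .of_norm_bounded ha.memWiener.2 fun j => le_mul_of_one_le_right (norm_nonneg _) ?_
  exact Real.one_le_rpow (by linarith [abs_nonneg (j : ℝ)]) (by norm_num)

theorem MemCSL.hasSum (ha : MemCSL 2 a) (z : Circle) :
    HasSum (fun j : ℤ => coeff a j * (z : ℂ) ^ j) (a z) := by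
  let f : C(AddCircle (2 * Real.pi), ℂ) :=
    ⟨fun x => a (toCircle x), ha.memWiener.1.comp continuous_toCircle⟩
  obtain ⟨x, rfl⟩ := (homeomorphCircle Real.two_pi_pos.ne').surjective z
  have h := has_pointwise_sum_fourier_series_of_summable (f := f) ha.summable_coeff x
  simp only [fourier_apply, toCircle_zsmul, Circle.coe_zpow] at h
  rw [homeomorphCircle_apply]
  exact h

theorem MemCSL.apply_sub_apply (ha : MemCSL 2 a) (z w : Circle) :
    a z - a w = ((w : ℂ) + (w : ℂ)⁻¹ - (z + (z : ℂ)⁻¹)) * diffQuotient (coeff a) z w :=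
  sub_eq_mul_diffQuotient ha.coeff_neg z.coe_ne_zero w.coe_ne_zero (ha.hasSum z) (ha.hasSum w)

theorem MemCSL.continuous_diffQuotient (ha : MemCSL 2 a) :
    Continuous fun p : Circle × Circle => diffQuotient (coeff a) p.1 p.2 :=
  continuous_diffQuotient_coe ha.summable_coeff_mul_sq

theorem MemCSL.hasDerivAt_g (ha : MemCSL 2 a) (φ : ℝ) :
    HasDerivAt (g a)
      (((2 * Real.sin φ : ℝ) : ℂ) * diffQuotient (coeff a) (Circle.exp φ) (Circle.exp φ)) φ := by
  have hcos : HasDerivAt (fun ψ : ℝ => ((2 * Real.cos φ - 2 * Real.cos ψ : ℝ) : ℂ))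
      ((2 * Real.sin φ : ℝ) : ℂ) φ := by
    simpa using (((Real.hasDerivAt_cos φ).const_mul 2).const_sub (2 * Real.cos φ)).ofReal_comp
  have hquot : Continuous fun ψ : ℝ => diffQuotient (coeff a) (Circle.exp ψ) (Circle.exp φ) :=
    ha.continuous_diffQuotient.comp₂ Circle.exp.continuous continuous_const
  refine ((hasDerivAt_mul_of_eq_zero hcos (by simp) hquot.continuousAt).add_const
    (g a φ)).congr_of_eventuallyEq (.of_forall fun ψ => eq_add_of_sub_eq ?_)
  rw [g, g, ha.apply_sub_apply, exp_add_inv, exp_add_inv, ← Complex.ofReal_sub]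

theorem MemCSL.iteratedDeriv_two_g (ha : MemCSL 2 a) {φ : ℝ} (hφ : Real.sin φ = 0) :
    iteratedDeriv 2 (g a) φ =
      ((2 * Real.cos φ : ℝ) : ℂ) * diffQuotient (coeff a) (Circle.exp φ) (Circle.exp φ) := by
  have hsin : HasDerivAt (fun ψ : ℝ => ((2 * Real.sin ψ : ℝ) : ℂ)) ((2 * Real.cos φ : ℝ) : ℂ) φ :=
    ((Real.hasDerivAt_sin φ).const_mul 2).ofReal_comp
  have hquot : Continuous fun ψ : ℝ => diffQuotient (coeff a) (Circle.exp ψ) (Circle.exp ψ) :=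
    ha.continuous_diffQuotient.comp₂ Circle.exp.continuous Circle.exp.continuous
  rw [iteratedDeriv_succ, iteratedDeriv_one,
    show deriv (g a) = _ from funext fun ψ => (ha.hasDerivAt_g ψ).deriv]
  exact (hasDerivAt_mul_of_eq_zero hsin (by simp [hφ]) hquot.continuousAt).deriv

theorem MemCSL.diffQuotient_exp_ne_zero (ha : MemCSL 2 a) {φ ψ : ℝ}
    (hφ : φ ∈ Set.Icc 0 Real.pi) (hψ : ψ ∈ Set.Icc 0 Real.pi) :
    diffQuotient (coeff a) (Circle.exp φ) (Circle.exp ψ) ≠ 0 := by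
  intro h
  have heq : g a φ - g a ψ = 0 := by rw [g, g, ha.apply_sub_apply, h, mul_zero]
  obtain rfl := ha.simple_arc hφ hψ (sub_eq_zero.1 heq)
  rcases hφ.1.eq_or_lt with rfl | hpos
  · exact ha.deriv2_zero_ne (by rw [ha.iteratedDeriv_two_g Real.sin_zero, h, mul_zero])
  rcases hφ.2.eq_or_lt with rfl | hlt
  · exact ha.deriv2_pi_ne (by rw [ha.iteratedDeriv_two_g Real.sin_pi, h, mul_zero])
  · exact ha.deriv_ne φ ⟨hpos, hlt⟩ (by rw [(ha.hasDerivAt_g φ).deriv, h, mul_zero])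

theorem MemCSL.diffQuotient_ne_zero (ha : MemCSL 2 a) (z : Circle) {φ : ℝ}
    (hφ : φ ∈ Set.Icc 0 Real.pi) : diffQuotient (coeff a) z (Circle.exp φ) ≠ 0 := by
  obtain ⟨ψ, hψ, rfl | rfl⟩ := exists_mem_Icc_circleExp z
  · exact ha.diffQuotient_exp_ne_zero hψ hφ
  · rw [Circle.coe_inv, diffQuotient_inv]
    exact ha.diffQuotient_exp_ne_zero hψ hφ

/-- The map sending `w` to the even symbol `x ↦ (a(x) - a(w)) / (w + w⁻¹ - (x + x⁻¹))`, where
`a ∈ CSL²` is viewed as a function on the additive circle. For `w = e^{iφ}`, `0 ≤ φ ≤ π`, these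
are the limits of the symbols `b̂_n`. -/
def MemCSL.limitSymbol (ha : MemCSL 2 a) : C(Circle, C(AddCircle (2 * Real.pi), ℂ)) :=
  ContinuousMap.curry ⟨fun p => diffQuotient (coeff a) (toCircle p.2) p.1,
    ha.continuous_diffQuotient.comp₂ (continuous_toCircle.comp continuous_snd) continuous_fst⟩

@[simp]
theorem MemCSL.limitSymbol_apply (ha : MemCSL 2 a) (w : Circle) (x : AddCircle (2 * Real.pi)) :
    ha.limitSymbol w x = diffQuotient (coeff a) (toCircle x) w := rfl

theorem MemCSL.isUnit_limitSymbol (ha : MemCSL 2 a) {φ : ℝ} (hφ : φ ∈ Set.Icc 0 Real.pi) :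
    IsUnit (ha.limitSymbol (Circle.exp φ)) :=
  ContinuousMap.isUnit_iff_forall_ne_zero _ |>.2 fun x => ha.diffQuotient_ne_zero (toCircle x) hφ

end ArcSymbol

section TruncatedSymbol

instance nullSingletonClass_haarAddCircle {T : ℝ} [hT : Fact (0 < T)] :
    NullSingletonClass (haarAddCircle (T := T)) where
  measure_singleton x := by
    have h := AddCircle.volume_closedBall T (x := x) 0
    rw [Metric.closedBall_zero, mul_zero, min_eq_right hT.out.le, ENNReal.ofReal_zero,
      volume_eq_smul_haarAddCircle, Measure.smul_apply, smul_eq_mul, mul_eq_zero] at h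
    exact h.resolve_left (ENNReal.ofReal_pos.2 hT.out).ne'

variable {α : ℝ} {a : Circle → ℂ}

/-- The Fourier coefficients of the Laurent polynomial `a_n`. -/
def truncCoeff (a : Circle → ℂ) (n : ℕ) : ℤ → ℂ :=
  (Set.Icc (-((n : ℤ) - 1)) ((n : ℤ) - 1)).indicator (coeff a)

theorem finite_support_truncCoeff (a : Circle → ℂ) (n : ℕ) :
    (Function.support (truncCoeff a n)).Finite :=
  (Set.finite_Icc _ _).subset Set.support_indicator_subset

theorem hasSum_truncCoeff (a : Circle → ℂ) (n : ℕ) (z : ℂ) :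
    HasSum (fun j => truncCoeff a n j * z ^ j) (aN a n z) := by
  have h := (Finset.Icc (-((n : ℤ) - 1)) ((n : ℤ) - 1)).hasSum (fun j => coeff a j * z ^ j)
  rw [hasSum_subtype_iff_indicator, Finset.coe_Icc] at h
  exact h.congr_fun fun j => (Set.indicator_mul_left ..).symm

theorem MemCSL.truncCoeff_neg (ha : MemCSL α a) (n : ℕ) (j : ℤ) :
    truncCoeff a n (-j) = truncCoeff a n j := by
  have h : -j ∈ Set.Icc (-((n : ℤ) - 1)) ((n : ℤ) - 1) ↔
      j ∈ Set.Icc (-((n : ℤ) - 1)) ((n : ℤ) - 1) := by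
    simp only [Set.mem_Icc]
    omega
  simp only [truncCoeff, Set.indicator_apply, h, ha.coeff_neg]

theorem MemCSL.aN_sub_aN (ha : MemCSL α a) (n : ℕ) {z w : ℂ} (hz : z ≠ 0) (hw : w ≠ 0) :
    aN a n z - aN a n w = (w + w⁻¹ - (z + z⁻¹)) * diffQuotient (truncCoeff a n) z w :=
  sub_eq_mul_diffQuotient (ha.truncCoeff_neg n) hz hw (hasSum_truncCoeff a n z)
    (hasSum_truncCoeff a n w)

theorem MemCSL.aN_inv (ha : MemCSL α a) (n : ℕ) {z : ℂ} (hz : z ≠ 0) :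
    aN a n z⁻¹ = aN a n z := by
  have h := ha.aN_sub_aN n (inv_ne_zero hz) hz
  rwa [inv_inv, add_comm z⁻¹, sub_self, zero_mul, sub_eq_zero] at h

theorem continuous_diffQuotient_left {F : ℤ → ℂ} (hF : F.support.Finite) {w : ℂ} (hw : w ≠ 0) :
    Continuous fun z : Circle => diffQuotient F z w := by
  have hwq : w ∈ annulus (max ‖w‖ ‖w⁻¹‖) := ⟨hw, le_max_left _ _, le_max_right _ _⟩
  refine (continuousOn_diffQuotient (summable_of_hasFiniteSupport ?_)).comp_continuous
    (f := fun z : Circle => ((z : ℂ), w)) (by fun_prop)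
    fun z => ⟨annulus_mono (one_le_of_mem_annulus hwq) (coe_mem_annulus_one z), hwq⟩
  refine (hF.preimage Nat.cast_injective.injOn).subset fun j hj h => hj ?_
  simp only [h, norm_zero, zero_mul]

/-- The continuous function on the additive circle that agrees with `hatB a n s` outside of the
removable singularities. -/
def hatSymbol (a : Circle → ℂ) (n : ℕ) (s : ℂ) : C(AddCircle (2 * Real.pi), ℂ) :=
  ⟨fun x => diffQuotient (truncCoeff a n) (toCircle x) (Complex.exp (Complex.I * s)),
    (continuous_diffQuotient_left (finite_support_truncCoeff a n) (Complex.exp_ne_zero _)).comp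
      continuous_toCircle⟩

theorem hatSymbol_apply (a : Circle → ℂ) (n : ℕ) (s : ℂ) (x : AddCircle (2 * Real.pi)) :
    hatSymbol a n s x =
      diffQuotient (truncCoeff a n) (toCircle x) (Complex.exp (Complex.I * s)) := rfl

theorem hatSymbol_neg (a : Circle → ℂ) (n : ℕ) (s : ℂ) (x : AddCircle (2 * Real.pi)) :
    hatSymbol a n s (-x) = hatSymbol a n s x := by
  rw [hatSymbol_apply, hatSymbol_apply, toCircle_neg, Circle.coe_inv, diffQuotient_inv]

theorem MemCSL.hatB_toCircle (ha : MemCSL α a) (n : ℕ) {s : ℂ} {x : AddCircle (2 * Real.pi)}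
    (h₁ : (toCircle x : ℂ) ≠ Complex.exp (Complex.I * s))
    (h₂ : (toCircle x : ℂ)⁻¹ ≠ Complex.exp (Complex.I * s)) :
    hatB a n s (toCircle x) = hatSymbol a n s x := by
  have ht := (toCircle x).coe_ne_zero
  have hw := Complex.exp_ne_zero (Complex.I * s)
  rw [hatSymbol_apply, hatB, gN, ha.aN_sub_aN n ht hw,
    div_eq_iff (mul_ne_zero (sub_ne_zero.2 h₁) (sub_ne_zero.2 h₂))]
  field_simp
  ring

theorem MemCSL.toeplitz_hatB (ha : MemCSL α a) (n : ℕ) (s : ℂ) (N : ℕ) :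
    toeplitz N (hatB a n s) = fourierToeplitz N (hatSymbol a n s) := by
  ext i j
  refine congrFun (fourierCoeff_congr_ae ?_) _
  set w := Complex.exp (Complex.I * s)
  have hinj : Function.Injective fun x : AddCircle (2 * Real.pi) => (toCircle x : ℂ) :=
    Subtype.val_injective.comp (injective_toCircle Real.two_pi_pos.ne')
  have hfin : ((fun x : AddCircle (2 * Real.pi) => (toCircle x : ℂ)) ⁻¹' {w, w⁻¹}).Finite :=
    (Set.toFinite _).preimage hinj.injOn
  filter_upwards [compl_mem_ae_iff.2 (hfin.measure_zero haarAddCircle)] with x hx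
  simp only [Set.mem_compl_iff, Set.mem_preimage, Set.mem_insert_iff, Set.mem_singleton_iff,
    not_or] at hx
  exact ha.hatB_toCircle n hx.1 fun h => hx.2 (inv_eq_iff_eq_inv.1 h)

theorem MemCSL.tildeB_eq_hatB (ha : MemCSL α a) (n : ℕ) (s : ℂ) : tildeB a n s = hatB a n s := by
  ext t
  rw [tildeB, hatB, hatB, Circle.coe_inv, ha.aN_inv n t.coe_ne_zero, inv_inv,
    mul_comm ((t : ℂ)⁻¹ - _)]

end TruncatedSymbol

section Rectangle

variable {ι : Type*} {a : Circle → ℂ} {c C : ℝ} {n : ℕ} {s : ℂ}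

theorem eventually_forall_mem_of_ultrafilter {X : Type*} {l : Filter ι} {S : ι → Set X}
    {P : ι → X → Prop}
    (h : ∀ 𝒰 : Ultrafilter (ι × X), Tendsto Prod.fst (𝒰 : Filter (ι × X)) l →
      (∀ᶠ p : ι × X in 𝒰, p.2 ∈ S p.1) →
      ∀ᶠ p : ι × X in 𝒰, P p.1 p.2) :
    ∀ᶠ i in l, ∀ x ∈ S i, P i x := by
  have key : ∀ᶠ p in comap Prod.fst l ⊓ 𝓟 {p : ι × X | p.2 ∈ S p.1}, P p.1 p.2 :=
    mem_iff_ultrafilter.2 fun 𝒰 h𝒰 => h 𝒰 (tendsto_iff_comap.2 (h𝒰.trans inf_le_left))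
      (le_principal_iff.1 (h𝒰.trans inf_le_right))
  rw [eventually_inf_principal, eventually_comap] at key
  exact key.mono fun i hi x hx => hi (i, x) rfl hx

theorem injOn_cos_strip : Set.InjOn Complex.cos {z | z.re ∈ Set.Ioo 0 Real.pi} := by
  intro s hs σ hσ h
  simp only [Set.mem_ofPred_eq, Set.mem_Ioo] at hs hσ
  obtain ⟨k, hk | hk⟩ := Complex.cos_eq_cos_iff.1 h
  all_goals have hre := congrArg Complex.re hk
  · norm_num at hre
    have hlt : (k : ℝ) < 1 := by nlinarith [Real.pi_pos]
    have hgt : (-1 : ℝ) < k := by nlinarith [Real.pi_pos]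
    obtain rfl : k = 0 := by
      norm_cast at hlt hgt
      omega
    simpa using hk.symm
  · norm_num at hre
    have hlt : (k : ℝ) < 1 := by nlinarith [Real.pi_pos]
    have hgt : (0 : ℝ) < k := by nlinarith [Real.pi_pos]
    norm_cast at hlt hgt
    omega

theorem exp_I_mul_add_inv (s : ℂ) :
    Complex.exp (Complex.I * s) + (Complex.exp (Complex.I * s))⁻¹ = 2 * Complex.cos s := by
  rw [Complex.two_cos, ← Complex.exp_neg, neg_mul, mul_comm]

theorem exp_I_mul_ne_inv (hs : s.re ∈ Set.Ioo 0 Real.pi) :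
    Complex.exp (Complex.I * s) ≠ (Complex.exp (Complex.I * s))⁻¹ := by
  intro h
  have hsin : Complex.sin s = 0 := by
    rw [Complex.sin, neg_mul, Complex.exp_neg, mul_comm s, ← h, sub_self, zero_mul, zero_div]
  obtain ⟨k, rfl⟩ := Complex.sin_eq_zero_iff.1 hsin
  norm_num at hs
  have hlt : (k : ℝ) < 1 := by nlinarith [Real.pi_pos]
  have hgt : (0 : ℝ) < k := by nlinarith [Real.pi_pos]
  norm_cast at hlt hgt
  omega

theorem re_mem_Ioo_of_mem_PiN (hc : 0 < c) (hn : 0 < n) (hs : s ∈ PiN c C n) :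
    s.re ∈ Set.Ioo 0 Real.pi := by
  have : 0 < c / n := by positivity
  exact ⟨this.trans_le hs.1.1, by linarith [hs.1.2]⟩

theorem exp_mem_annulus_of_mem_PiN (hs : s ∈ PiN c C n) :
    Complex.exp (Complex.I * s) ∈ annulus (Real.exp (C / n)) := by
  refine ⟨Complex.exp_ne_zero _, ?_⟩
  rw [← Complex.exp_neg, Complex.norm_exp, Complex.norm_exp, Real.exp_le_exp, Real.exp_le_exp,
    Complex.neg_re, Complex.I_mul_re, neg_neg]
  exact ⟨by linarith [hs.2.1], hs.2.2⟩

theorem exists_tendsto_exp_of_mem_PiN (hc : 0 < c) (𝒰 : Ultrafilter ι) {n : ι → ℕ} {s : ι → ℂ}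
    (hn : Tendsto n 𝒰 atTop) (hs : ∀ᶠ i in 𝒰, s i ∈ PiN c C (n i)) :
    ∃ φ ∈ Set.Icc 0 Real.pi,
      Tendsto (fun i => Complex.exp (Complex.I * s i)) 𝒰 (𝓝 (Circle.exp φ)) := by
  have hre : ∀ᶠ i in 𝒰, (s i).re ∈ Set.Icc 0 Real.pi := by
    filter_upwards [hs, hn.eventually_gt_atTop 0] with i hi hni
    exact Set.Ioo_subset_Icc_self (re_mem_Ioo_of_mem_PiN hc hni hi)
  obtain ⟨φ, hφ, hre_lim⟩ :=
    isCompact_Icc.ultrafilter_le_nhds (𝒰.map fun i => (s i).re) (le_principal_iff.2 hre)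
  have hwidth : Tendsto (fun i => C / n i) 𝒰 (𝓝 0) :=
    tendsto_const_nhds.div_atTop (tendsto_natCast_atTop_atTop.comp hn)
  have him_lim : Tendsto (fun i => (s i).im) 𝒰 (𝓝 0) :=
    tendsto_of_tendsto_of_tendsto_of_le_of_le' (by simpa using hwidth.neg) hwidth
      (hs.mono fun _ hi => hi.2.1) (hs.mono fun _ hi => hi.2.2)
  have hlim : Tendsto s 𝒰 (𝓝 (φ : ℂ)) := by
    simpa only [Complex.ofReal_zero, zero_mul, add_zero, Complex.re_add_im] using
      (Tendsto.ofReal hre_lim).add (him_lim.ofReal.mul_const Complex.I)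
  refine ⟨φ, hφ, ?_⟩
  rw [Circle.coe_exp, mul_comm (φ : ℂ)]
  exact (Complex.continuous_exp.tendsto _).comp (hlim.const_mul Complex.I)

theorem norm_truncCoeff_mul_le (hC : 0 ≤ C) (a : Circle → ℂ) (n j : ℕ) :
    ‖truncCoeff a n j‖ * (Real.exp (C / n) ^ j) ^ 5 ≤ Real.exp C ^ 5 * ‖coeff a j‖ := by
  by_cases hj : (j : ℤ) ∈ Set.Icc (-((n : ℤ) - 1)) ((n : ℤ) - 1)
  · have hjn : j < n := by have := hj.2; omega
    have hn : (0 : ℝ) < n := by exact_mod_cast j.zero_le.trans_lt hjn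
    have hexp : Real.exp (C / n) ^ j ≤ Real.exp C := by
      rw [← Real.exp_nat_mul, Real.exp_le_exp, mul_div_left_comm]
      exact mul_le_of_le_one_right hC ((div_le_one hn).2 (by exact_mod_cast hjn.le))
    rw [truncCoeff, Set.indicator_of_mem hj, mul_comm]
    gcongr
  · rw [truncCoeff, Set.indicator_of_notMem hj, norm_zero, zero_mul]
    positivity

theorem tendsto_truncCoeff (a : Circle → ℂ) {l : Filter ι} {n : ι → ℕ} (hn : Tendsto n l atTop)
    (j : ℕ) : Tendsto (fun i => truncCoeff a (n i) j) l (𝓝 (coeff a j)) := by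
  refine tendsto_const_nhds.congr' ?_
  filter_upwards [hn.eventually_gt_atTop j] with i hi
  exact (Set.indicator_of_mem (Set.mem_Icc.2 ⟨by omega, by omega⟩) _).symm

theorem MemCSL.tendsto_diffQuotient_truncCoeff (ha : MemCSL 2 a) (hC : 0 ≤ C) {l : Filter ι}
    {n : ι → ℕ} (hn : Tendsto n l atTop) {z w : ι → ℂ} {z₀ w₀ : Circle}
    (hzq : ∀ᶠ i in l, z i ∈ annulus (Real.exp (C / n i)))
    (hwq : ∀ᶠ i in l, w i ∈ annulus (Real.exp (C / n i)))
    (hz : Tendsto z l (𝓝 z₀)) (hw : Tendsto w l (𝓝 w₀)) :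
    Tendsto (fun i => diffQuotient (truncCoeff a (n i)) (z i) (w i)) l
      (𝓝 (diffQuotient (coeff a) z₀ w₀)) := by
  have hB : Summable fun j : ℕ => Real.exp C ^ 5 * ‖coeff a j‖ * (j : ℝ) ^ 2 := by
    simpa only [mul_assoc] using ha.summable_coeff_mul_sq.mul_left (Real.exp C ^ 5)
  exact tendsto_diffQuotient hB (.of_forall fun i => norm_truncCoeff_mul_le hC a (n i))
    (tendsto_truncCoeff a hn) hzq hwq hz hw z₀.coe_ne_zero w₀.coe_ne_zero

theorem MemCSL.tendsto_hatSymbol (ha : MemCSL 2 a) (hC : 0 ≤ C) {l : Filter ι} {n : ι → ℕ}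
    {s : ι → ℂ} {w₀ : Circle} (hn : Tendsto n l atTop) (hs : ∀ᶠ i in l, s i ∈ PiN c C (n i))
    (hw : Tendsto (fun i => Complex.exp (Complex.I * s i)) l (𝓝 w₀)) :
    Tendsto (fun i => hatSymbol a (n i) (s i)) l (𝓝 (ha.limitSymbol w₀)) := by
  rw [ContinuousMap.tendsto_iff_tendstoLocallyUniformly, tendstoLocallyUniformly_iff_forall_tendsto]
  intro x
  have hann : ∀ᶠ p : ι × AddCircle (2 * Real.pi) in l ×ˢ 𝓝 x,
      Complex.exp (Complex.I * s p.1) ∈ annulus (Real.exp (C / n p.1)) :=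
    tendsto_fst.eventually (hs.mono fun _ => exp_mem_annulus_of_mem_PiN)
  have htoCircle : Tendsto (fun p : ι × AddCircle (2 * Real.pi) => (toCircle p.2 : ℂ)) (l ×ˢ 𝓝 x)
      (𝓝 (toCircle x : ℂ)) :=
    ((continuous_subtype_val.comp continuous_toCircle).tendsto x).comp tendsto_snd
  have hhat : Tendsto (fun p : ι × AddCircle (2 * Real.pi) => hatSymbol a (n p.1) (s p.1) p.2)
      (l ×ˢ 𝓝 x) (𝓝 (ha.limitSymbol w₀ x)) :=
    ha.tendsto_diffQuotient_truncCoeff hC (hn.comp tendsto_fst)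
      (hann.mono fun p hp => annulus_mono (one_le_of_mem_annulus hp) (coe_mem_annulus_one _)) hann
      htoCircle (hw.comp tendsto_fst)
  have hlimit : Tendsto (fun p : ι × AddCircle (2 * Real.pi) => ha.limitSymbol w₀ p.2)
      (l ×ˢ 𝓝 x) (𝓝 (ha.limitSymbol w₀ x)) :=
    ((ha.limitSymbol w₀).continuous.tendsto x).comp tendsto_snd
  exact (hlimit.prodMk_nhds hhat).mono_right (nhds_le_uniformity _)

theorem MemCSL.eventually_injOn_gN (ha : MemCSL 2 a) (hc : 0 < c) (hC : 0 ≤ C) :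
    ∀ᶠ n in atTop, Set.InjOn (gN a n) (PiN c C n) := by
  have key : ∀ᶠ n in atTop, ∀ p ∈ (PiN c C n ×ˢ PiN c C n : Set (ℂ × ℂ)),
      gN a n p.1 = gN a n p.2 → p.1 = p.2 := by
    refine eventually_forall_mem_of_ultrafilter fun 𝒰 hn hmem => ?_
    have hs : ∀ᶠ p : ℕ × ℂ × ℂ in 𝒰, p.2.1 ∈ PiN c C p.1 := hmem.mono fun _ hp => hp.1
    have hσ : ∀ᶠ p : ℕ × ℂ × ℂ in 𝒰, p.2.2 ∈ PiN c C p.1 := hmem.mono fun _ hp => hp.2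
    obtain ⟨φ, hφ, hz⟩ := exists_tendsto_exp_of_mem_PiN hc 𝒰 hn hs
    obtain ⟨ψ, hψ, hw⟩ := exists_tendsto_exp_of_mem_PiN hc 𝒰 hn hσ
    have hlim := ha.tendsto_diffQuotient_truncCoeff hC hn
      (hs.mono fun _ => exp_mem_annulus_of_mem_PiN) (hσ.mono fun _ => exp_mem_annulus_of_mem_PiN)
      hz hw
    filter_upwards [hlim.eventually_ne (ha.diffQuotient_exp_ne_zero hφ hψ), hs, hσ,
      hn.eventually_gt_atTop 0] with p hne hsp hσp hpos heq
    have h := ha.aN_sub_aN p.1 (Complex.exp_ne_zero (Complex.I * p.2.1))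
      (Complex.exp_ne_zero (Complex.I * p.2.2))
    rw [← gN, ← gN, heq, sub_self, zero_eq_mul, or_iff_left hne, sub_eq_zero, exp_I_mul_add_inv,
      exp_I_mul_add_inv, mul_right_inj' two_ne_zero] at h
    exact injOn_cos_strip (re_mem_Ioo_of_mem_PiN hc hpos hsp) (re_mem_Ioo_of_mem_PiN hc hpos hσp)
      h.symm
  exact key.mono fun n hn s hs σ hσ => hn (s, σ) ⟨hs, hσ⟩

theorem MemCSL.eventually_hatSymbol_of_nhdsSet (ha : MemCSL 2 a) (hc : 0 < c) (hC : 0 ≤ C)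
    {P : C(AddCircle (2 * Real.pi), ℂ) → Prop}
    (hP : ∀ᶠ b in 𝓝ˢ ((fun φ : ℝ => ha.limitSymbol (Circle.exp φ)) '' Set.Icc 0 Real.pi), P b) :
    ∀ᶠ n in atTop, ∀ s ∈ PiN c C n, P (hatSymbol a n s) := by
  refine eventually_forall_mem_of_ultrafilter fun 𝒰 hn hs => ?_
  obtain ⟨φ, hφ, hw⟩ := exists_tendsto_exp_of_mem_PiN hc 𝒰 hn hs
  exact (ha.tendsto_hatSymbol hC hn hs hw).eventually
    (eventually_nhdsSet_iff_forall.1 hP _ (Set.mem_image_of_mem _ hφ))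

theorem MemCSL.exists_antilipschitzWith_toeplitz_hatB (ha : MemCSL 2 a) (hc : 0 < c)
    (hC : 0 ≤ C) :
    ∃ K : ℝ≥0, ∀ᶠ n in atTop, ∀ s ∈ PiN c C n,
      AntilipschitzWith K (Matrix.toEuclideanCLM (𝕜 := ℂ) (toeplitz (n + 2) (hatB a n s))) := by
  set 𝒦 := (fun φ : ℝ => ha.limitSymbol (Circle.exp φ)) '' Set.Icc 0 Real.pi
  have hcompact : IsCompact 𝒦 :=
    isCompact_Icc.image (ha.limitSymbol.continuous.comp Circle.exp.continuous)
  obtain ⟨N₀, K, hK⟩ := exists_antilipschitzWith_fourierToeplitz_of_isCompact hcompact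
    (by
      rintro _ ⟨φ, -, rfl⟩ x
      rw [ha.limitSymbol_apply, ha.limitSymbol_apply, toCircle_neg, Circle.coe_inv,
        diffQuotient_inv])
    (by
      rintro _ ⟨φ, hφ, rfl⟩
      exact ha.isUnit_limitSymbol hφ)
  refine ⟨K, ?_⟩
  filter_upwards [ha.eventually_hatSymbol_of_nhdsSet hc hC hK, eventually_ge_atTop N₀]
    with n hn hN₀ s hs
  rw [ha.toeplitz_hatB]
  exact hn s hs (n + 2) (by omega)

end Rectangle

section CoefficientVectors

open Polynomial

theorem exists_ofFn_eq_iff_degree_lt {R : Type*} [Semiring R] [DecidableEq R] {N : ℕ} {p : R[X]} :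
    (∃ x, ofFn N x = p) ↔ p.degree < N := by
  refine ⟨?_, fun hp => ⟨toFn N p, ?_⟩⟩
  · rintro ⟨x, rfl⟩
    exact ofFn_degree_lt x
  · rcases eq_or_ne p 0 with rfl | h0
    · rw [toFn_zero, ofFn_zero]
    · exact ofFn_comp_toFn_eq_id_of_natDegree_lt ((natDegree_lt_iff_degree_lt h0).2 hp)

theorem exists_ofFn_eq_iff_exists_ofFn_eq_mul {R : Type*} [CommRing R] [DecidableEq R] {q : R[X]}
    (hq : q.Monic) {n : ℕ} {p : R[X]} :
    (∃ y, ofFn (n + q.natDegree) y = q * p) ↔ ∃ x, ofFn n x = p := by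
  nontriviality R
  rw [exists_ofFn_eq_iff_degree_lt, exists_ofFn_eq_iff_degree_lt, mul_comm, hq.degree_mul,
    degree_eq_natDegree hq.ne_zero, Nat.cast_add]
  exact WithBot.add_lt_add_iff_right (WithBot.coe_ne_bot)

variable {K : Type*} [Field K]

theorem X_sub_C_mul_X_sub_C_dvd_iff {v w : K} (h : v ≠ w) {p : K[X]} :
    (X - C v) * (X - C w) ∣ p ↔ p.eval v = 0 ∧ p.eval w = 0 := by
  rw [← IsRoot.def, ← IsRoot.def, ← dvd_iff_isRoot, ← dvd_iff_isRoot]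
  exact ⟨fun hp => ⟨dvd_of_mul_right_dvd hp, dvd_of_mul_left_dvd hp⟩, fun hp =>
    (isCoprime_X_sub_C_of_isUnit_sub (sub_ne_zero.2 h).isUnit).mul_dvd hp.1 hp.2⟩

variable [DecidableEq K]

theorem eval_ofFn_eq_sum {N : ℕ} (u : Fin N → K) (z : K) :
    (ofFn N u).eval z = ∑ k, u k * z ^ (k : ℕ) := by
  rw [ofFn_eq_sum_monomial, eval_finsetSum]
  simp only [eval_monomial]

theorem eval_ofFn_comp_rev {m : ℕ} (u : Fin (m + 1) → K) {z : K} (hz : z ≠ 0) :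
    (ofFn (m + 1) (u ∘ Fin.rev)).eval z = z ^ m * (ofFn (m + 1) u).eval z⁻¹ := by
  rw [eval_ofFn_eq_sum, eval_ofFn_eq_sum, ← Equiv.sum_comp Fin.revPerm, Finset.mul_sum]
  refine Finset.sum_congr rfl fun k _ => ?_
  rw [Fin.revPerm_apply, Function.comp_apply, Fin.rev_rev, Fin.val_rev, mul_left_comm, inv_pow,
    Nat.add_sub_add_right, pow_sub₀ z hz (by omega)]

end CoefficientVectors

section BoundaryRows

variable {K : Type*} [Field K]

theorem exists_mem_span_pair_iff {V : Type*} [AddCommGroup V] [Module K V] {u v : V}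
    (huv : LinearIndependent K ![u, v]) (φ ψ : V →ₗ[K] K) :
    (∃ y ∈ Submodule.span K {u, v}, y ≠ 0 ∧ φ y = 0 ∧ ψ y = 0) ↔ φ u * ψ v - φ v * ψ u = 0 := by
  rw [← Matrix.det_fin_two_of, ← Matrix.exists_mulVec_eq_zero_iff]
  simp only [Submodule.mem_span_pair]
  constructor
  · rintro ⟨_, ⟨p, q, rfl⟩, h0, hφ, hψ⟩
    refine ⟨![p, q], fun h => h0 ?_, ?_⟩
    · have hp : p = 0 := congrFun h 0
      have hq : q = 0 := congrFun h 1
      rw [hp, hq, zero_smul, zero_smul, add_zero]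
    · ext i
      fin_cases i
      · simpa [mul_comm] using hφ
      · simpa [mul_comm] using hψ
  · rintro ⟨x, h0, hx⟩
    refine ⟨_, ⟨x 0, x 1, rfl⟩, fun h => h0 ?_, ?_⟩
    · obtain ⟨hp, hq⟩ := LinearIndependent.pair_iff.1 huv _ _ h
      ext i
      fin_cases i
      exacts [hp, hq]
    · have hφ := congrFun hx 0
      have hψ := congrFun hx 1
      simp only [Matrix.mulVec, dotProduct, Fin.sum_univ_two, Matrix.of_apply,
        Matrix.cons_val_zero, Matrix.cons_val_one, Pi.zero_apply] at hφ hψ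
      simp only [map_add, map_smul, smul_eq_mul]
      exact ⟨by linear_combination hφ, by linear_combination hψ⟩

theorem forall_castSucc_succ_eq_zero_iff {n : ℕ} {y : Fin (n + 2) → K} :
    (∀ i : Fin n, y i.castSucc.succ = 0) ↔
      ∃ p q : K, p • Pi.single 0 1 + q • Pi.single (Fin.last (n + 1)) 1 = y := by
  have hlast (i : Fin n) : i.castSucc.succ ≠ Fin.last (n + 1) := by
    simpa only [← Fin.succ_last, Ne, Fin.succ_inj] using (Fin.castSucc_lt_last i).ne
  refine ⟨fun h => ⟨y 0, y (Fin.last _), ?_⟩, ?_⟩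
  · ext k
    induction k using Fin.cases with
    | zero => simp
    | succ k =>
      induction k using Fin.lastCases with
      | last => simp [Fin.succ_last]
      | cast i => simp [h i, hlast i]
  · rintro ⟨p, q, rfl⟩ i
    simp [hlast i]

variable {n : ℕ} {A : Matrix (Fin (n + 2)) (Fin (n + 2)) K}

theorem mulVec_inv_mulVec {ι : Type*} [Fintype ι] [DecidableEq ι] {A : Matrix ι ι K}
    (hA : IsUnit A) (x : ι → K) : A.mulVec (A⁻¹.mulVec x) = x := by
  rw [Matrix.mulVec_mulVec, Matrix.mul_nonsing_inv _ ((Matrix.isUnit_iff_isUnit_det A).1 hA),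
    Matrix.one_mulVec]

theorem mulVec_smul_add_smul_comp_rev (hA : IsUnit A) (hrev : A.submatrix Fin.rev Fin.rev = A)
    (p q : K) :
    A.mulVec (p • A⁻¹.mulVec (Pi.single 0 1) + q • (A⁻¹.mulVec (Pi.single 0 1) ∘ Fin.rev)) =
      p • Pi.single 0 1 + q • Pi.single (Fin.last (n + 1)) 1 := by
  have hlast : (Pi.single 0 1 : Fin (n + 2) → K) ∘ Fin.rev = Pi.single (Fin.last (n + 1)) 1 := by
    ext k
    simp only [Function.comp_apply, Pi.single_apply, Fin.rev_eq_iff, Fin.rev_zero]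
  rw [Matrix.mulVec_add, Matrix.mulVec_smul, Matrix.mulVec_smul, mulVec_comp_rev hrev,
    mulVec_inv_mulVec hA, hlast]

theorem linearIndependent_inv_mulVec_comp_rev (hA : IsUnit A)
    (hrev : A.submatrix Fin.rev Fin.rev = A) :
    LinearIndependent K ![A⁻¹.mulVec (Pi.single 0 1), A⁻¹.mulVec (Pi.single 0 1) ∘ Fin.rev] := by
  refine LinearIndependent.pair_iff.2 fun p q h => ?_
  have hpq := mulVec_smul_add_smul_comp_rev hA hrev p q
  rw [h, Matrix.mulVec_zero] at hpq
  exact ⟨by simpa using (congrFun hpq 0).symm, by simpa using (congrFun hpq (Fin.last _)).symm⟩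

theorem forall_mulVec_castSucc_succ_eq_zero_iff (hA : IsUnit A)
    (hrev : A.submatrix Fin.rev Fin.rev = A) {y : Fin (n + 2) → K} :
    (∀ i : Fin n, A.mulVec y i.castSucc.succ = 0) ↔
      y ∈ Submodule.span K
        {A⁻¹.mulVec (Pi.single 0 1), A⁻¹.mulVec (Pi.single 0 1) ∘ Fin.rev} := by
  rw [forall_castSucc_succ_eq_zero_iff, Submodule.mem_span_pair]
  refine exists₂_congr fun p q => ?_
  rw [← mulVec_smul_add_smul_comp_rev hA hrev]
  exact (Matrix.mulVec_injective_iff_isUnit.2 hA).eq_iff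

open Polynomial in
theorem exists_boundary_solution_eval_eq_zero_iff [DecidableEq K] (hA : IsUnit A)
    (hrev : A.submatrix Fin.rev Fin.rev = A) {w : K} (hw : w ≠ 0) {U : K[X]}
    (hU : U = ofFn (n + 2) (A⁻¹.mulVec (Pi.single 0 1))) :
    (∃ y, (∀ i : Fin n, A.mulVec y i.castSucc.succ = 0) ∧ y ≠ 0 ∧
        (ofFn (n + 2) y).eval w = 0 ∧ (ofFn (n + 2) y).eval w⁻¹ = 0) ↔
      U.eval w * (w⁻¹ ^ (n + 1) * U.eval w) - w ^ (n + 1) * U.eval w⁻¹ * U.eval w⁻¹ = 0 := by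
  have hindep := linearIndependent_inv_mulVec_comp_rev hA hrev
  have key := exists_mem_span_pair_iff hindep
    (leval w ∘ₗ ofFn (n + 2)) (leval w⁻¹ ∘ₗ ofFn (n + 2))
  simpa only [← forall_mulVec_castSucc_succ_eq_zero_iff hA hrev, LinearMap.comp_apply,
    leval_apply, eval_ofFn_comp_rev _ hw, eval_ofFn_comp_rev _ (inv_ne_zero hw), inv_inv,
    ← hU] using key

theorem hasEigenvalue_toLin'_iff {ι : Type*} [Fintype ι] [DecidableEq ι] {A : Matrix ι ι K}
    {μ : K} : Module.End.HasEigenvalue (Matrix.toLin' A) μ ↔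
      ∃ x, x ≠ 0 ∧ (algebraMap K (Matrix ι ι K) μ - A).mulVec x = 0 := by
  rw [Module.End.hasEigenvalue_iff_mem_spectrum, Matrix.spectrum_toLin', spectrum.mem_iff,
    Matrix.isUnit_iff_isUnit_det, isUnit_iff_ne_zero, not_not, ← Matrix.exists_mulVec_eq_zero_iff]

end BoundaryRows

section SymbolFactor

open Polynomial

variable {T : ℝ} [Fact (0 < T)]

theorem fourierCoeff_fourier_mul (b : C(AddCircle T, ℂ)) (m k : ℤ) :
    fourierCoeff (fourier m * b : C(AddCircle T, ℂ)) k = fourierCoeff b (k - m) := by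
  rw [← sub_zero k, ← inner_fourierLp_circleMul_fourierLp, mul_comm, map_mul,
    mul_apply_eq_comp, circleMul_fourier_fourierLp, inner_fourierLp_circleMul_fourierLp,
    zero_add, sub_zero]

theorem fourierToeplitz_mulVec (b : C(AddCircle T, ℂ)) {N : ℕ} (y : Fin N → ℂ) (i : Fin N) :
    (fourierToeplitz N b).mulVec y i =
      fourierCoeff (b * aeval (fourier 1 : C(AddCircle T, ℂ)) (ofFn N y)) i := by
  have hpow (k : ℕ) : circleMul (fourier 1 ^ k : C(AddCircle T, ℂ)) (fourierLp 2 0) =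
      fourierLp 2 k := by
    induction k with
    | zero => simp
    | succ k ih =>
      rw [pow_succ', map_mul, mul_apply_eq_comp, ih, circleMul_fourier_fourierLp, Nat.cast_succ]
  have hsum : circleMul (aeval (fourier 1 : C(AddCircle T, ℂ)) (ofFn N y)) (fourierLp 2 0) =
      ∑ k, y k • fourierLp (T := T) 2 k := by
    simp only [ofFn_eq_sum_monomial, map_sum, aeval_monomial, ← Algebra.smul_def, map_smul, hpow,
      sum_apply, smul_apply]
  rw [← sub_zero (i : ℤ), ← inner_fourierLp_circleMul_fourierLp, map_mul, mul_apply_eq_comp, hsum,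
    map_sum, inner_sum]
  simp only [map_smul, inner_smul_right, inner_fourierLp_circleMul_fourierLp, Matrix.mulVec,
    dotProduct, fourierToeplitz, Matrix.of_apply, mul_comm]

theorem fourierToeplitz_mulVec_of_mul_eq {b f : C(AddCircle T, ℂ)} {q : ℂ[X]} {m : ℤ}
    (hbf : b * aeval (fourier 1 : C(AddCircle T, ℂ)) q = fourier m * f) {n N : ℕ} {x : Fin n → ℂ}
    {y : Fin N → ℂ} (hy : ofFn N y = q * ofFn n x) {i : Fin n} {k : Fin N}
    (hik : (k : ℤ) = i + m) :
    (fourierToeplitz N b).mulVec y k = (fourierToeplitz n f).mulVec x i := by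
  rw [fourierToeplitz_mulVec, fourierToeplitz_mulVec, hy, map_mul, ← mul_assoc, hbf, mul_assoc,
    fourierCoeff_fourier_mul, hik, add_sub_cancel_right]

theorem exists_fourierToeplitz_mulVec_eq_zero_iff {b f : C(AddCircle T, ℂ)} {v w : ℂ}
    (hvw : v ≠ w)
    (hbf : b * aeval (fourier 1 : C(AddCircle T, ℂ)) ((X - C v) * (X - C w)) = fourier 1 * f)
    (n : ℕ) :
    (∃ x, x ≠ 0 ∧ (fourierToeplitz n f).mulVec x = 0) ↔
      ∃ y, (∀ i : Fin n, (fourierToeplitz (n + 2) b).mulVec y i.castSucc.succ = 0) ∧ y ≠ 0 ∧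
        (ofFn (n + 2) y).eval v = 0 ∧ (ofFn (n + 2) y).eval w = 0 := by
  have hq : ((X - C v) * (X - C w)).Monic := (monic_X_sub_C v).mul (monic_X_sub_C w)
  have hdeg : ((X - C v) * (X - C w)).natDegree = 2 := by
    rw [(monic_X_sub_C v).natDegree_mul (monic_X_sub_C w), natDegree_X_sub_C, natDegree_X_sub_C]
  have hfactor {p : ℂ[X]} := exists_ofFn_eq_iff_exists_ofFn_eq_mul hq (n := n) (p := p)
  rw [hdeg] at hfactor
  have hrow {x : Fin n → ℂ} {y} (hy : ofFn (n + 2) y = (X - C v) * (X - C w) * ofFn n x)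
      (i : Fin n) : (fourierToeplitz (n + 2) b).mulVec y i.castSucc.succ =
        (fourierToeplitz n f).mulVec x i :=
    fourierToeplitz_mulVec_of_mul_eq hbf hy (by simp)
  have hne {x : Fin n → ℂ} {y} (hy : ofFn (n + 2) y = (X - C v) * (X - C w) * ofFn n x) :
      y ≠ 0 ↔ x ≠ 0 := by
    rw [← (injective_ofFn (n + 2)).ne_iff, ← (injective_ofFn n).ne_iff, map_zero, map_zero, hy,
      mul_ne_zero_iff, and_iff_right hq.ne_zero]
  constructor
  · rintro ⟨x, h0, hx⟩
    obtain ⟨y, hy⟩ := hfactor.2 ⟨x, rfl⟩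
    exact ⟨y, fun i => (hrow hy i).trans (congrFun hx i), (hne hy).2 h0,
      (X_sub_C_mul_X_sub_C_dvd_iff hvw).1 ⟨_, hy⟩⟩
  · rintro ⟨y, hrows, h0, heval⟩
    obtain ⟨p, hp⟩ := (X_sub_C_mul_X_sub_C_dvd_iff hvw).2 heval
    obtain ⟨x, rfl⟩ := hfactor.1 ⟨y, hp⟩
    exact ⟨x, (hne hp).1 h0, funext fun i => (hrow hp i).symm.trans (hrows i)⟩

end SymbolFactor

section EigenvalueCriterion

open Polynomial

variable {α : ℝ} {a : Circle → ℂ}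

/-- The function `λ - a_n` on the additive circle, where `λ = g_n(s)`. -/
def shiftedSymbol (a : Circle → ℂ) (n : ℕ) (s : ℂ) : C(AddCircle (2 * Real.pi), ℂ) :=
  gN a n s • fourier 0 -
    ∑ j ∈ Finset.Icc (-((n : ℤ) - 1)) ((n : ℤ) - 1), coeff a j • fourier j

theorem shiftedSymbol_apply (a : Circle → ℂ) (n : ℕ) (s : ℂ) (x : AddCircle (2 * Real.pi)) :
    shiftedSymbol a n s x = gN a n s - aN a n (toCircle x) := by
  simp [shiftedSymbol, aN, fourier_apply, toCircle_zsmul]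

theorem fourierToeplitz_shiftedSymbol (a : Circle → ℂ) (n : ℕ) (s : ℂ) :
    fourierToeplitz n (shiftedSymbol a n s) =
      algebraMap ℂ (Matrix (Fin n) (Fin n) ℂ) (gN a n s) - toeplitz n a := by
  ext i j
  have hmem : (i : ℤ) - j ∈ Finset.Icc (-((n : ℤ) - 1)) ((n : ℤ) - 1) := by
    rw [Finset.mem_Icc]
    omega
  have hsum : ∑ k ∈ Finset.Icc (-((n : ℤ) - 1)) ((n : ℤ) - 1),
      coeff a k * (if (i : ℤ) = j + k then 1 else 0) = coeff a (i - j) := by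
    simp only [← sub_eq_iff_eq_add', mul_ite, mul_one, mul_zero, Finset.sum_ite_eq, if_pos hmem]
  rw [fourierToeplitz, Matrix.of_apply, ← inner_fourierLp_circleMul_fourierLp, shiftedSymbol,
    map_sub, map_sum, sub_apply, sum_apply, inner_sub_right, inner_sum]
  simp only [map_smul, smul_apply, circleMul_fourier_fourierLp, inner_smul_right,
    orthonormal_iff_ite.1 orthonormal_fourier, hsum]
  simp [Matrix.algebraMap_matrix_apply, toeplitz, Fin.ext_iff]

theorem MemCSL.hatSymbol_mul_aeval_fourier (ha : MemCSL α a) (n : ℕ) (s : ℂ) :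
    hatSymbol a n s * aeval (fourier 1 : C(AddCircle (2 * Real.pi), ℂ))
      ((X - C (Complex.exp (Complex.I * s))) * (X - C (Complex.exp (Complex.I * s))⁻¹)) =
      fourier 1 * shiftedSymbol a n s := by
  ext x
  have ht := (toCircle x).coe_ne_zero
  have hw := Complex.exp_ne_zero (Complex.I * s)
  have h := ha.aN_sub_aN n ht hw
  rw [← hatSymbol_apply] at h
  simp only [map_mul, map_sub, aeval_X, aeval_C, ContinuousMap.mul_apply, ContinuousMap.sub_apply,
    Algebra.algebraMap_eq_smul_one, ContinuousMap.smul_apply, ContinuousMap.one_apply, fourier_one,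
    smul_eq_mul, mul_one, shiftedSymbol_apply, gN]
  field_simp at h ⊢
  linear_combination h

theorem MemCSL.hatTheta_eq_Theta_inv (ha : MemCSL α a) (n : ℕ) (s z : ℂ) :
    hatTheta a n s z = Theta a n s z⁻¹ := by
  rw [hatTheta, ha.tildeB_eq_hatB, Theta]

theorem MemCSL.hasEigenvalue_toeplitz_iff (ha : MemCSL α a) {n : ℕ} {s : ℂ}
    (hs : Complex.exp (Complex.I * s) ≠ (Complex.exp (Complex.I * s))⁻¹)
    (hunit : IsUnit (toeplitz (n + 2) (hatB a n s))) :
    Module.End.HasEigenvalue (Matrix.toLin' (toeplitz n a)) (gN a n s) ↔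
      Complex.exp (-(Complex.I * (n + 1) * s)) * Theta a n s (Complex.exp (Complex.I * s)) *
          hatTheta a n s (Complex.exp (-(Complex.I * s))) -
        Complex.exp (Complex.I * (n + 1) * s) * Theta a n s (Complex.exp (-(Complex.I * s))) *
          hatTheta a n s (Complex.exp (Complex.I * s)) = 0 := by
  rw [ha.toeplitz_hatB] at hunit
  have hTheta (z : ℂ) : Theta a n s z = (ofFn (n + 2)
      ((fourierToeplitz (n + 2) (hatSymbol a n s))⁻¹.mulVec (Pi.single 0 1))).eval z := by
    rw [Theta, invChiZero, ha.toeplitz_hatB, eval_ofFn_eq_sum]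
  have hpow : Complex.exp (Complex.I * (n + 1) * s) = Complex.exp (Complex.I * s) ^ (n + 1) := by
    rw [← Complex.exp_nat_mul, Nat.cast_add_one, mul_comm Complex.I, mul_assoc]
  rw [hasEigenvalue_toLin'_iff, ← fourierToeplitz_shiftedSymbol,
    exists_fourierToeplitz_mulVec_eq_zero_iff hs (ha.hatSymbol_mul_aeval_fourier n s),
    exists_boundary_solution_eval_eq_zero_iff hunit
      (fourierToeplitz_submatrix_rev (hatSymbol_neg a n s) _) (Complex.exp_ne_zero _) rfl]
  simp only [ha.hatTheta_eq_Theta_inv, Complex.exp_neg, hpow, inv_inv, inv_pow, hTheta]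
  exact iff_of_eq (congrArg (· = 0) (by ring))

end EigenvalueCriterion

end ToeplitzCSL

end

theorem mainTheorem4 (α : ℝ) (hα : 2 ≤ α) (a : Circle → ℂ) (ha : ToeplitzCSL.MemCSL α a)
    (c C : ℝ) (hc : 0 < c) (hC : 0 < C) :
    ∃ (N₀ : ℕ) (M : ℝ), ∀ n : ℕ, N₀ < n →
      Set.InjOn (ToeplitzCSL.gN a n) (ToeplitzCSL.PiN c C n) ∧
      ∀ s ∈ ToeplitzCSL.PiN c C n,
        IsUnit (ToeplitzCSL.toeplitz (n + 2) (ToeplitzCSL.hatB a n s)) ∧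
        ‖Matrix.toEuclideanCLM (𝕜 := ℂ)
          (ToeplitzCSL.toeplitz (n + 2) (ToeplitzCSL.hatB a n s))⁻¹‖ ≤ M ∧
        IsUnit (ToeplitzCSL.toeplitz (n + 2) (ToeplitzCSL.tildeB a n s)) ∧
        ‖Matrix.toEuclideanCLM (𝕜 := ℂ)
          (ToeplitzCSL.toeplitz (n + 2) (ToeplitzCSL.tildeB a n s))⁻¹‖ ≤ M ∧
        (Module.End.HasEigenvalue (Matrix.toLin' (ToeplitzCSL.toeplitz n a))
            (ToeplitzCSL.gN a n s) ↔
          Complex.exp (-(Complex.I * (n + 1) * s)) *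
              ToeplitzCSL.Theta a n s (Complex.exp (Complex.I * s)) *
              ToeplitzCSL.hatTheta a n s (Complex.exp (-(Complex.I * s))) -
            Complex.exp (Complex.I * (n + 1) * s) *
              ToeplitzCSL.Theta a n s (Complex.exp (-(Complex.I * s))) *
              ToeplitzCSL.hatTheta a n s (Complex.exp (Complex.I * s)) = 0) := by
  replace ha := ha.mono hα
  obtain ⟨K, hstable⟩ := ha.exists_antilipschitzWith_toeplitz_hatB hc hC.le
  obtain ⟨N₀, hN₀⟩ := Filter.eventually_atTop.1
    (((ha.eventually_injOn_gN hc hC.le).and hstable).and (Filter.eventually_gt_atTop 0))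
  refine ⟨N₀, K, fun n hn => ?_⟩
  obtain ⟨⟨hinj, hanti⟩, hpos⟩ := hN₀ n hn.le
  refine ⟨hinj, fun s hs => ?_⟩
  obtain ⟨hunit, hnorm⟩ := ToeplitzCSL.isUnit_and_norm_toEuclideanCLM_inv_le (hanti s hs)
  rw [ha.tildeB_eq_hatB]
  exact ⟨hunit, hnorm, hunit, hnorm, ha.hasEigenvalue_toeplitz_iff
    (ToeplitzCSL.exp_I_mul_ne_inv (ToeplitzCSL.re_mem_Ioo_of_mem_PiN hc hpos hs)) hunit⟩
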